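/- Let $\Omega\subset\mathbb{R}^d$ be a non-empty compact convex set with (Euclidean) diameter $D$, let $L>0$, and let $f=\frac1n\sum_{i=1}^n f_i$, where each $f_i:\mathbb{R}^d\to\mathbb{R}$ is differentiable, convex and $L$-smooth, that is, $\nabla f_i(v)^\top(w-v)\le f_i(w)-f_i(v)\le\nabla f_i(v)^\top(w-v)+\frac L2\|w-v\|^2$ for all $w,v\in\mathbb{R}^d$. Let $w^*\in\arg\min_{w\in\Omega}f(w)$ be any minimizer. For $w,w_0\in\Omega$, a sample of the variance-reduced stochastic gradient $\tilde\nabla f(w;w_0)$ is $\nabla f_i(w)-(\nabla f_i(w_0)-\nabla f(w_0))$ with $i$ uniform on $\{1,\dots,n\}$. The algorithm STORC with parameters $\gamma_k,\beta_k,\eta_{t,k},m_{t,k},N_t$ is the following. Take an arbitrary $x\in\Omega$ and $w_0\in\arg\min_{w\in\Omega}\nabla f(x)^\top w$. For $t=1,2,\dots$: set $x_0=y_0=w_{t-1}$; for $k=1,\dots,N_t$ let 1. $z_k=(1-\gamma_k)y_{k-1}+\gamma_k x_{k-1}$; 2. $\tilde\nabla_k$ be the average of $m_{t,k}$ fresh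 i.i.d. samples of $\tilde\nabla f(z_k;y_0)$; 3. $x_k\in\Omega$ be the output of the Frank-Wolfe algorithm for $\min_{x\in\Omega}g(x)$, $g(x)=\frac{\beta_k}2\|x-x_{k-1}\|^2+\tilde\nabla_k^\top x$, run until the duality gap satisfies $\max_{x\in\Omega}\nabla g(x_k)^\top(x_k-x)\le\eta_{t,k}$ (starting point in $\Omega$, step sizes in $[0,1]$ and tie-breaking are arbitrary, and the output is determined by $t,k,x_{k-1},\tilde\nabla_k$); 4. $y_k=(1-\gamma_k)y_{k-1}+\gamma_k x_k$; and then set $w_t=y_{N_t}$. Let $$\gamma_k=\frac{2}{k+1},\qquad \beta_k=\frac{3L}{k},\qquad \eta_{t,k}=\frac{2LD_t^2}{N_tk}.$$ Then $\mathbb{E}[f(w_t)-f(w^*)]\le\frac{LD^2}{2^{t+1}}$ for every $t\ge0$ in each of the following three cases: (a) $\nabla f(w^*)=0$, with $D_t=D$, $N_t=\lceil 2^{t/2+2}\rceil$, $m_{t,k}=900N_t$; (b) $f$ is $G$-Lipschitz on $\Omega$, i.e. $\|\nabla f(w)\|\le G$ for all $w\in\Omega$, with $D_t=D$, $N_t=\lceil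 2^{t/2+2}\rceil$, $m_{t,k}=\left\lceil 700N_t+\frac{24N_tG(k+1)}{LD}\right\rceil$ (if $D=0$ the fraction is read as $0$); (c) $f$ is $\alpha$-strongly convex on $\Omega$ with $\alpha>0$, i.e. $f(w)-f(v)\le\nabla f(w)^\top(w-v)-\frac\alpha2\|w-v\|^2$ for all $w,v\in\Omega$, with $\mu=L/\alpha$, $D_t^2=\frac{\mu D^2}{2^{t-1}}$, $N_t=\lceil\sqrt{32\mu}\,\rceil$, $m_{t,k}=\lceil 5600N_t\mu\rceil$. -/

import Mathlib

noncomputable section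

namespace STORC

open MeasureTheory ProbabilityTheory

/-- The Euclidean space `ℝ^d`. -/
abbrev Vec (d : ℕ) : Type := EuclideanSpace ℝ (Fin d)

/-- `h` is differentiable, convex and `L`-smooth on all of `ℝ^d`. -/
structure IsConvexSmooth {d : ℕ} (L : ℝ) (h : Vec d → ℝ) : Prop where
  differentiable : Differentiable ℝ h
  lower : ∀ w v : Vec d, inner ℝ (gradient h v) (w - v) ≤ h w - h v
  upper : ∀ w v : Vec d,
    h w - h v ≤ inner ℝ (gradient h v) (w - v) + L / 2 * ‖w - v‖ ^ 2

/-- `h` is `G`-Lipschitz on `K`: its gradient is bounded by `G` there. -/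
def IsGLipschitz {d : ℕ} (K : Set (Vec d)) (G : ℝ) (h : Vec d → ℝ) : Prop :=
  ∀ w ∈ K, ‖gradient h w‖ ≤ G

/-- `h` is `α`-strongly convex on `K`. -/
def IsStronglyConvex {d : ℕ} (K : Set (Vec d)) (α : ℝ) (h : Vec d → ℝ) : Prop :=
  ∀ w ∈ K, ∀ v ∈ K,
    h w - h v ≤ inner ℝ (gradient h w) (w - v) - α / 2 * ‖w - v‖ ^ 2

/-- The objective `f = (1/n) ∑ i, f_i`. -/
def objective {d n : ℕ} (F : Fin n → Vec d → ℝ) (w : Vec d) : ℝ :=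
  (1 / (n : ℝ)) * ∑ i, F i w

/-- `v` is a minimizer over `K` of the linear function `u ↦ ⟨c, u⟩`. -/
def IsLinearArgmin {d : ℕ} (K : Set (Vec d)) (c v : Vec d) : Prop :=
  v ∈ K ∧ ∀ u ∈ K, inner ℝ c v ≤ inner ℝ c u

/-- The duality gap `max_{u ∈ K} ⟨∇h(x), x - u⟩` of `h` at `x` is at most `η`. -/
def DualityGapLE {d : ℕ} (K : Set (Vec d)) (h : Vec d → ℝ) (η : ℝ) (x : Vec d) : Prop :=
  ∀ u ∈ K, inner ℝ (gradient h x) (x - u) ≤ η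

/-- `x` is the output of a run of Frank-Wolfe for `min_{u ∈ K} h u`, stopped as soon as the duality
gap is at most `η`. The starting point in `K`, the step sizes in `[0, 1]` and the choice among
several minimizers of the linear subproblem are arbitrary. -/
def IsFrankWolfeOutput {d : ℕ} (K : Set (Vec d)) (h : Vec d → ℝ) (η : ℝ) (x : Vec d) : Prop :=
  ∃ (u v : ℕ → Vec d) (ρ : ℕ → ℝ) (J : ℕ),
    u 0 ∈ K ∧
    (∀ j < J, ¬ DualityGapLE K h η (u j) ∧
      IsLinearArgmin K (gradient h (u j)) (v j) ∧
      ρ j ∈ Set.Icc (0 : ℝ) 1 ∧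
      u (j + 1) = (1 - ρ j) • u j + ρ j • v j) ∧
    DualityGapLE K h η (u J) ∧
    x = u J

/-- The variance-reduced stochastic gradient at `w` with snapshot `w₀` and sampled index `i`. -/
def vrGrad {d n : ℕ} (F : Fin n → Vec d → ℝ) (w w₀ : Vec d) (i : Fin n) : Vec d :=
  gradient (F i) w - (gradient (F i) w₀ - gradient (objective F) w₀)

/-- The average of `m` variance-reduced stochastic gradients, with sampled indices
`idx 0, …, idx (m - 1)`. -/
def batchGrad {d n : ℕ} (F : Fin n → Vec d → ℝ) (m : ℕ) (w w₀ : Vec d) (idx : ℕ → Fin n) : Vec d :=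
  (1 / (m : ℝ)) • ∑ j ∈ Finset.range m, vrGrad F w w₀ (idx j)

/-- The objective `g(x) = (β/2) ‖x - x'‖² + ⟨c, x⟩` of the inner problem. -/
def subproblem {d : ℕ} (β : ℝ) (x' c : Vec d) (x : Vec d) : ℝ :=
  β / 2 * ‖x - x'‖ ^ 2 + inner ℝ c x

/-- The parameters of the algorithm; `t` and `k` count from `1`. -/
structure Params where
  γ : ℕ → ℝ
  β : ℕ → ℝ
  η : ℕ → ℕ → ℝ
  m : ℕ → ℕ → ℕ
  N : ℕ → ℕ

/-- `solver t k x' c` is what the inner Frank-Wolfe routine returns in outer iteration `t` and inner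
iteration `k`, when called with previous point `x'` and gradient estimate `c`. -/
def IsFrankWolfeSolver {d : ℕ} (K : Set (Vec d)) (p : Params)
    (solver : ℕ → ℕ → Vec d → Vec d → Vec d) : Prop :=
  ∀ t k : ℕ, 1 ≤ t → 1 ≤ k → k ≤ p.N t → ∀ x' ∈ K, ∀ c : Vec d,
    IsFrankWolfeOutput K (subproblem (p.β k) x' c) (p.η t k) (solver t k x' c)

/-- The pair `(x_k, y_k)` of inner iteration `k` of outer iteration `t`, started at the snapshot
`y₀`; `idx k j` is the `j`-th index sampled in inner iteration `k`. -/
def innerLoop {d n : ℕ} (F : Fin n → Vec d → ℝ) (p : Params)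
    (solver : ℕ → ℕ → Vec d → Vec d → Vec d) (t : ℕ) (y₀ : Vec d) (idx : ℕ → ℕ → Fin n) :
    ℕ → Vec d × Vec d
  | 0 => (y₀, y₀)
  | k + 1 =>
    let x' := (innerLoop F p solver t y₀ idx k).1
    let y' := (innerLoop F p solver t y₀ idx k).2
    let z := (1 - p.γ (k + 1)) • y' + p.γ (k + 1) • x'
    let x := solver t (k + 1) x' (batchGrad F (p.m t (k + 1)) z y₀ (idx (k + 1)))
    (x, (1 - p.γ (k + 1)) • y' + p.γ (k + 1) • x)

/-- The iterate `w_t` of the algorithm started at `w₀`; `idx t k j` is the `j`-th index sampled in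
inner iteration `k` of outer iteration `t`. -/
def iterate {d n : ℕ} (F : Fin n → Vec d → ℝ) (p : Params)
    (solver : ℕ → ℕ → Vec d → Vec d → Vec d) (w₀ : Vec d) (idx : ℕ → ℕ → ℕ → Fin n) : ℕ → Vec d
  | 0 => w₀
  | t + 1 =>
    (innerLoop F p solver (t + 1) (iterate F p solver w₀ idx t) (idx (t + 1)) (p.N (t + 1))).2

/-- The random indices `idx t k j` are independent and uniformly distributed on the `n` indices. -/
structure IsIIDUniform {S : Type*} [MeasurableSpace S] (P : Measure S) {n : ℕ}
    (idx : ℕ → ℕ → ℕ → S → Fin n) : Prop where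
  measurable : ∀ t k j, Measurable (idx t k j)
  indep : iIndepFun (fun s : ℕ × ℕ × ℕ => idx s.1 s.2.1 s.2.2) P
  uniform : ∀ t k j, ∀ i : Fin n, P {ω | idx t k j ω = i} = (n : ENNReal)⁻¹

/-- The parameters `γ_k = 2/(k+1)`, `β_k = 3L/k`, `η_{t,k} = 2 L D_t² / (N_t k)`. -/
def params (L : ℝ) (Dt : ℕ → ℝ) (N : ℕ → ℕ) (m : ℕ → ℕ → ℕ) : Params where
  γ k := 2 / ((k : ℝ) + 1)
  β k := 3 * L / (k : ℝ)
  η t k := 2 * L * Dt t ^ 2 / ((N t : ℝ) * (k : ℝ))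
  m := m
  N := N

end STORC

end

/-! Each outer iteration is an accelerated proximal gradient method with inexact gradients and
inexact prox steps. With γ = 2/(k+1) and β = 3L/k, the potential k(k+1)(f(y_k) - f*) + 3L‖x_k - w*‖²
telescopes: one step adds at most 4L D_t²/N_t for the duality gap, (k²/L)‖δ_k‖² for the gradient
error δ_k, and a term linear in δ_k that has mean zero (`innerLoop_potential_le`).

The error term is self-bounding. The variance of a sample at z_k is controlled by γ_k²‖x_{k-1} -
y_{k-1}‖² and by the optimality gaps at y_{k-1} and at the snapshot
(`sum_norm_vrGrad_sub_sq_le_of_mem`), and the potential controls the first two of these. So an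
induction on k gives k²·variance ≤ 700 L² D_t². A batch of 700 N_t samples then makes the noise cost
at most L D_t²/N_t per step, and after N_t steps the potential is at most (3 + 4 + 1) L D_t²
(`integral_innerLoop_le`).

Hence N_t(N_t+1) E[f(w_t) - f*] ≤ 8 L D_t² whenever E‖w_{t-1} - w*‖² ≤ D_t², and the choice of N_t
halves the bound on the gap (`integral_iterate_le`). The distance condition comes from the diameter
in the first two cases and from quadratic growth in the third.

No measurability of the solver is needed: each iterate is a function of finitely many indices with
values in a finite set, hence measurable and bounded. -/

noncomputable section

namespace STORC

open MeasureTheory ProbabilityTheory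

/-! ### Deterministic estimates: smoothness, one accelerated step, variance of one sample. -/

section Deterministic

variable {d n : ℕ} {L : ℝ}

/-- Gradients of a convex `L`-smooth function are cocoercive. -/
theorem IsConvexSmooth.norm_gradient_sub_sq_le {h : Vec d → ℝ} (hL : 0 < L)
    (hh : IsConvexSmooth L h) (u v : Vec d) :
    ‖gradient h u - gradient h v‖ ^ 2 ≤
      2 * L * (h u - h v - inner ℝ (gradient h v) (u - v)) := by
  set g := gradient h u - gradient h v with hg
  -- The test point is a gradient step from u for h minus its linearization at v; that difference is
  -- nonnegative at every point.
  have h1 := hh.lower (u - (1 / L) • g) v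
  have h2 := hh.upper (u - (1 / L) • g) u
  have e1 : u - (1 / L) • g - v = (u - v) - (1 / L) • g := by abel
  have e2 : u - (1 / L) • g - u = -((1 / L) • g) := by abel
  have hgg : inner ℝ (gradient h u) g - inner ℝ (gradient h v) g = ‖g‖ ^ 2 := by
    rw [← inner_sub_left, ← hg, real_inner_self_eq_norm_sq]
  rw [e1, inner_sub_right, inner_smul_right] at h1
  rw [e2, inner_neg_right, inner_smul_right, norm_neg, norm_smul, mul_pow, Real.norm_eq_abs,
    sq_abs] at h2
  have e3 : L / 2 * ((1 / L) ^ 2 * ‖g‖ ^ 2) = 1 / L * (‖g‖ ^ 2 / 2) := by field_simp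
  rw [e3] at h2
  have e4 : 1 / L * (‖g‖ ^ 2 / 2) ≤ h u - h v - inner ℝ (gradient h v) (u - v) := by
    have : 1 / L * ‖g‖ ^ 2 =
        1 / L * inner ℝ (gradient h u) g - 1 / L * inner ℝ (gradient h v) g := by
      rw [← hgg]; ring
    linarith
  have e5 : 2 * L * (1 / L * (‖g‖ ^ 2 / 2)) = ‖g‖ ^ 2 := by field_simp
  have := mul_le_mul_of_nonneg_left e4 (by positivity : 0 ≤ 2 * L)
  linarith

theorem IsConvexSmooth.norm_gradient_sub_sq_le_norm_sub_sq {h : Vec d → ℝ} (hL : 0 < L)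
    (hh : IsConvexSmooth L h) (u v : Vec d) :
    ‖gradient h u - gradient h v‖ ^ 2 ≤ L ^ 2 * ‖u - v‖ ^ 2 := by
  have h1 := hh.norm_gradient_sub_sq_le hL u v
  have h2 := hh.upper u v
  have h3 : 2 * L * (h u - h v - inner ℝ (gradient h v) (u - v)) ≤
      2 * L * (L / 2 * ‖u - v‖ ^ 2) := by
    apply mul_le_mul_of_nonneg_left _ (by positivity)
    linarith
  calc _ ≤ _ := h1
    _ ≤ _ := h3
    _ = _ := by ring

theorem gradient_objective {F : Fin n → Vec d → ℝ} (hF : ∀ i, Differentiable ℝ (F i))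
    (w : Vec d) : gradient (objective F) w = (1 / (n : ℝ)) • ∑ i, gradient (F i) w := by
  apply HasGradientAt.gradient
  rw [hasGradientAt_iff_hasFDerivAt]
  have h1 : HasFDerivAt (fun w => ∑ i, F i w) (∑ i, fderiv ℝ (F i) w) w :=
    HasFDerivAt.fun_sum fun i _ => (hF i w).hasFDerivAt
  have h2 := h1.const_mul (1 / (n : ℝ))
  have h3 : (InnerProductSpace.toDual ℝ (Vec d)) ((1 / (n : ℝ)) • ∑ i, gradient (F i) w) =
      (1 / (n : ℝ)) • ∑ i, fderiv ℝ (F i) w := by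
    simp [gradient]
  rw [h3]
  exact h2

theorem isConvexSmooth_objective (hn : 0 < n) {F : Fin n → Vec d → ℝ}
    (hF : ∀ i, IsConvexSmooth L (F i)) : IsConvexSmooth L (objective F) := by
  have hn' : (0 : ℝ) < n := by exact_mod_cast hn
  refine ⟨?_, fun w v => ?_, fun w v => ?_⟩
  · unfold objective
    have : ∀ i, Differentiable ℝ (F i) := fun i => (hF i).differentiable
    fun_prop
  · rw [gradient_objective fun i => (hF i).differentiable, inner_smul_left, sum_inner]
    simp only [objective, ← mul_sub, ← Finset.sum_sub_distrib, conj_trivial]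
    apply mul_le_mul_of_nonneg_left (Finset.sum_le_sum fun i _ => (hF i).lower w v) (by positivity)
  · rw [gradient_objective fun i => (hF i).differentiable, inner_smul_left, sum_inner]
    simp only [objective, ← mul_sub, ← Finset.sum_sub_distrib]
    have h1 : ∑ i, (F i w - F i v) ≤
        ∑ i, (inner ℝ (gradient (F i) v) (w - v) + L / 2 * ‖w - v‖ ^ 2) :=
      Finset.sum_le_sum fun i _ => (hF i).upper w v
    have h2 := mul_le_mul_of_nonneg_left h1 (by positivity : 0 ≤ 1 / (n : ℝ))
    rw [Finset.sum_add_distrib, mul_add, Finset.sum_const, Finset.card_univ, Fintype.card_fin,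
      nsmul_eq_mul, ← mul_assoc (1 / (n : ℝ)) (n : ℝ), one_div_mul_cancel hn'.ne', one_mul] at h2
    simpa using h2

/-- First-order optimality of a constrained minimizer. -/
theorem inner_gradient_nonneg_of_isMinOn {K : Set (Vec d)} (hK : Convex ℝ K) {h : Vec d → ℝ}
    (hh : IsConvexSmooth L h) {w : Vec d} (hw : w ∈ K) (hmin : ∀ u ∈ K, h w ≤ h u)
    {u : Vec d} (hu : u ∈ K) : 0 ≤ inner ℝ (gradient h w) (u - w) := by
  have hmin' : IsMinOn h K w := fun u hu => hmin u hu
  have h1 := hmin'.localize.hasFDerivWithinAt_nonneg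
    (hh.differentiable w).hasFDerivAt.hasFDerivWithinAt
    (sub_mem_posTangentConeAt_of_segment_subset (hK.segment_subset hw hu))
  simpa [gradient] using h1

theorem gradient_subproblem (β : ℝ) (x' c x : Vec d) :
    gradient (subproblem β x' c) x = β • (x - x') + c := by
  apply HasGradientAt.gradient
  rw [hasGradientAt_iff_hasFDerivAt]
  have h1 : HasFDerivAt (fun x : Vec d => x - x') (ContinuousLinearMap.id ℝ (Vec d)) x :=
    (hasFDerivAt_id x).sub_const x'
  have h2 := (h1.norm_sq).const_mul (β / 2)
  have h3 : HasFDerivAt (fun x : Vec d => inner ℝ c x) (innerSL ℝ c) x :=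
    (innerSL ℝ c).hasFDerivAt
  refine (h2.add h3).congr_fderiv ?_
  ext y
  simp
  ring

theorem IsFrankWolfeOutput.mem {K : Set (Vec d)} (hK : Convex ℝ K) {h : Vec d → ℝ} {η : ℝ}
    {x : Vec d} (hx : IsFrankWolfeOutput K h η x) : x ∈ K := by
  obtain ⟨u, v, ρ, J, h0, hstep, -, rfl⟩ := hx
  have : ∀ j ≤ J, u j ∈ K := by
    intro j
    induction j with
    | zero => exact fun _ => h0
    | succ j ih =>
      intro hj
      obtain ⟨-, hv, hρ, he⟩ := hstep j hj
      rw [he]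
      exact hK (ih (by omega)) hv.1 (by linarith [hρ.2]) hρ.1 (by ring)
  exact this J le_rfl

theorem IsFrankWolfeOutput.dualityGapLE {K : Set (Vec d)} {h : Vec d → ℝ} {η : ℝ}
    {x : Vec d} (hx : IsFrankWolfeOutput K h η x) : DualityGapLE K h η x := by
  obtain ⟨u, v, ρ, J, -, -, hgap, rfl⟩ := hx
  exact hgap

/-- Progress of one accelerated step whose proximal subproblem, built with the inexact gradient
`c`, is solved up to duality gap `η`. -/
theorem IsConvexSmooth.accelerated_step {K : Set (Vec d)} {f : Vec d → ℝ} (hf : IsConvexSmooth L f)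
    {γ β η : ℝ} (hγ0 : 0 ≤ γ) (hγ1 : γ ≤ 1) (hβ : L * γ < β) {w x' y' z c x : Vec d} (hw : w ∈ K)
    (hz : z = (1 - γ) • y' + γ • x') (hx : DualityGapLE K (subproblem β x' c) η x) :
    f ((1 - γ) • y' + γ • x) - f w ≤ (1 - γ) * (f y' - f w) +
      γ * (η + β / 2 * (‖x' - w‖ ^ 2 - ‖x - w‖ ^ 2) +
        ‖c - gradient f z‖ ^ 2 / (2 * (β - L * γ)) - inner ℝ (c - gradient f z) (x' - w)) := by
  set g := gradient f z with hg
  have h1 := hf.upper ((1 - γ) • y' + γ • x) z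
  have h2 := hf.lower y' z
  have h3 := hf.lower w z
  have h4 := hx w hw
  rw [gradient_subproblem, inner_add_left, inner_smul_left] at h4
  have e1 : (1 - γ) • y' + γ • x - z = γ • (x - x') := by rw [hz]; module
  have e2 : inner ℝ g ((1 - γ) • y' + γ • x - z) =
      (1 - γ) * inner ℝ g (y' - z) + γ * inner ℝ g (w - z) + γ * inner ℝ g (x - w) := by
    simp only [← inner_smul_right, ← inner_add_right]
    congr 1
    module
  have e3 : ‖(1 - γ) • y' + γ • x - z‖ ^ 2 = γ ^ 2 * ‖x - x'‖ ^ 2 := by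
    rw [e1, norm_smul, mul_pow, Real.norm_eq_abs, sq_abs]
  -- The noise c - g is split off against x' - w, which is fixed before c is drawn, so that this
  -- part averages to zero; the rest, against x - x', goes to Young's inequality.
  have e4 : inner ℝ g (x - w) = inner ℝ c (x - w) - inner ℝ (c - g) (x - x') -
      inner ℝ (c - g) (x' - w) := by
    rw [sub_sub, ← inner_add_right, sub_add_sub_cancel, inner_sub_left]; ring
  have e5 : inner ℝ (x - x') (x - w) =
      (‖x - x'‖ ^ 2 + ‖x - w‖ ^ 2 - ‖x' - w‖ ^ 2) / 2 := by
    have : x' - w = (x - w) - (x - x') := by abel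
    rw [this, norm_sub_sq_real (x - w) (x - x'), real_inner_comm (x - x')]; ring
  have hc : 0 < β - L * γ := by linarith
  -- The weight β - Lγ is what remains of the proximal term once the smoothness error is paid.
  have h5 : -inner ℝ (c - g) (x - x') ≤
      ‖c - g‖ ^ 2 / (2 * (β - L * γ)) + (β - L * γ) / 2 * ‖x - x'‖ ^ 2 := by
    have a1 := neg_le_of_abs_le (abs_real_inner_le_norm (c - g) (x - x'))
    have a2 : ‖c - g‖ * ‖x - x'‖ ≤
        ‖c - g‖ ^ 2 / (2 * (β - L * γ)) + (β - L * γ) / 2 * ‖x - x'‖ ^ 2 := by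
      have : ‖c - g‖ ^ 2 / (2 * (β - L * γ)) + (β - L * γ) / 2 * ‖x - x'‖ ^ 2 -
          ‖c - g‖ * ‖x - x'‖ =
          (‖c - g‖ - (β - L * γ) * ‖x - x'‖) ^ 2 / (2 * (β - L * γ)) := by
        field_simp; ring
      have : 0 ≤ (‖c - g‖ - (β - L * γ) * ‖x - x'‖) ^ 2 / (2 * (β - L * γ)) := by positivity
      linarith
    linarith
  rw [e2, e3] at h1
  rw [e5] at h4
  simp only [conj_trivial] at h4
  have h6 : inner ℝ g (x - w) ≤ η + β / 2 * (‖x' - w‖ ^ 2 - ‖x - w‖ ^ 2) +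
      ‖c - g‖ ^ 2 / (2 * (β - L * γ)) - inner ℝ (c - g) (x' - w) - L * γ / 2 * ‖x - x'‖ ^ 2 := by
    rw [e4]; nlinarith
  have h7 := mul_le_mul_of_nonneg_left h6 hγ0
  have h8 := mul_le_mul_of_nonneg_left h2 (by linarith : 0 ≤ 1 - γ)
  have h9 := mul_le_mul_of_nonneg_left h3 hγ0
  nlinarith

/-- The second moment of the variance-reduced gradient noise. -/
theorem sum_norm_vrGrad_sub_sq_le (hn : 0 < n) {F : Fin n → Vec d → ℝ}
    (hF : ∀ i, Differentiable ℝ (F i)) (z y : Vec d) :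
    (1 / (n : ℝ)) * ∑ i, ‖vrGrad F z y i - gradient (objective F) z‖ ^ 2 ≤
      (1 / (n : ℝ)) * ∑ i, ‖gradient (F i) z - gradient (F i) y‖ ^ 2 := by
  have hn' : (0 : ℝ) < n := by exact_mod_cast hn
  refine mul_le_mul_of_nonneg_left ?_ (by positivity)
  set m := gradient (objective F) z - gradient (objective F) y with hm
  have e : ∀ i, vrGrad F z y i - gradient (objective F) z =
      (gradient (F i) z - gradient (F i) y) - m := fun i => by rw [vrGrad, hm]; abel
  have hsum : ∑ i, (gradient (F i) z - gradient (F i) y) = (n : ℝ) • m := by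
    rw [hm, gradient_objective hF, gradient_objective hF, ← smul_sub, smul_smul,
      mul_one_div_cancel hn'.ne', one_smul, Finset.sum_sub_distrib]
  -- Variance equals second moment minus the squared mean.
  have : ∑ i, ‖vrGrad F z y i - gradient (objective F) z‖ ^ 2 =
      ∑ i, ‖gradient (F i) z - gradient (F i) y‖ ^ 2 - n * ‖m‖ ^ 2 := by
    simp only [e, norm_sub_sq_real, Finset.sum_add_distrib, Finset.sum_sub_distrib,
      ← Finset.mul_sum, ← sum_inner, hsum, inner_smul_left, real_inner_self_eq_norm_sq]
    simp
    ring
  rw [this]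
  have : 0 ≤ n * ‖m‖ ^ 2 := by positivity
  linarith

theorem sum_vrGrad_sub_eq_zero (hn : 0 < n) {F : Fin n → Vec d → ℝ}
    (hF : ∀ i, Differentiable ℝ (F i)) (z y : Vec d) :
    ∑ i, (vrGrad F z y i - gradient (objective F) z) = 0 := by
  have hn' : (0 : ℝ) < n := by exact_mod_cast hn
  have e : ∀ v, ∑ i, gradient (F i) v = (n : ℝ) • gradient (objective F) v := fun v => by
    rw [gradient_objective hF, smul_smul, mul_one_div_cancel hn'.ne', one_smul]
  simp only [vrGrad, Finset.sum_sub_distrib, e, Finset.sum_const, Finset.card_univ,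
    Fintype.card_fin, ← Nat.cast_smul_eq_nsmul ℝ]
  abel

/-- The mean squared distance of the component gradients to those at a constrained minimizer. -/
theorem sum_norm_gradient_sub_sq_le (hL : 0 < L) (hn : 0 < n) {K : Set (Vec d)} (hK : Convex ℝ K)
    {F : Fin n → Vec d → ℝ} (hF : ∀ i, IsConvexSmooth L (F i)) {w : Vec d} (hw : w ∈ K)
    (hmin : ∀ u ∈ K, objective F w ≤ objective F u) {u : Vec d} (hu : u ∈ K) :
    (1 / (n : ℝ)) * ∑ i, ‖gradient (F i) u - gradient (F i) w‖ ^ 2 ≤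
      2 * L * (objective F u - objective F w) := by
  have hn' : (0 : ℝ) < n := by exact_mod_cast hn
  -- Averaging cocoercivity leaves -⟨∇f(w), u - w⟩, which optimality makes nonpositive; ∇f(w) = 0 is
  -- not required.
  have h0 := inner_gradient_nonneg_of_isMinOn hK (isConvexSmooth_objective hn hF) hw hmin hu
  have h1 : ∑ i, ‖gradient (F i) u - gradient (F i) w‖ ^ 2 ≤
      ∑ i, 2 * L * (F i u - F i w - inner ℝ (gradient (F i) w) (u - w)) :=
    Finset.sum_le_sum fun i _ => (hF i).norm_gradient_sub_sq_le hL u w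
  have h2 := mul_le_mul_of_nonneg_left h1 (by positivity : 0 ≤ 1 / (n : ℝ))
  have h3 : (1 / (n : ℝ)) * ∑ i, 2 * L * (F i u - F i w - inner ℝ (gradient (F i) w) (u - w)) =
      2 * L * (objective F u - objective F w - inner ℝ (gradient (objective F) w) (u - w)) := by
    rw [gradient_objective fun i => (hF i).differentiable, inner_smul_left, sum_inner,
      ← Finset.mul_sum, Finset.sum_sub_distrib, Finset.sum_sub_distrib]
    simp only [objective, conj_trivial]
    ring
  rw [h3] at h2
  nlinarith

/-- Variance of one variance-reduced sample at `z`, with snapshot `y₀`, for `y` near `z`. -/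
theorem sum_norm_vrGrad_sub_sq_le_of_mem (hL : 0 < L) (hn : 0 < n) {K : Set (Vec d)}
    (hK : Convex ℝ K) {F : Fin n → Vec d → ℝ} (hF : ∀ i, IsConvexSmooth L (F i)) {w : Vec d}
    (hw : w ∈ K) (hmin : ∀ u ∈ K, objective F w ≤ objective F u) {y y₀ : Vec d} (hy : y ∈ K)
    (hy₀ : y₀ ∈ K) (z : Vec d) :
    (1 / (n : ℝ)) * ∑ i, ‖vrGrad F z y₀ i - gradient (objective F) z‖ ^ 2 ≤
      3 * (L ^ 2 * ‖z - y‖ ^ 2 + 2 * L * (objective F y - objective F w) +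
        2 * L * (objective F y₀ - objective F w)) := by
  have hn' : (0 : ℝ) < n := by exact_mod_cast hn
  refine (sum_norm_vrGrad_sub_sq_le hn (fun i => (hF i).differentiable) z y₀).trans ?_
  have h1 := sum_norm_gradient_sub_sq_le hL hn hK hF hw hmin hy
  have h2 := sum_norm_gradient_sub_sq_le hL hn hK hF hw hmin hy₀
  -- The path from z to y₀ goes through y and w; the 3 is from (a + b + c)² ≤ 3(a² + b² + c²).
  have h3 : ∑ i, ‖gradient (F i) z - gradient (F i) y₀‖ ^ 2 ≤
      ∑ i, 3 * (L ^ 2 * ‖z - y‖ ^ 2 + ‖gradient (F i) y - gradient (F i) w‖ ^ 2 +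
        ‖gradient (F i) y₀ - gradient (F i) w‖ ^ 2) := by
    refine Finset.sum_le_sum fun i _ => ?_
    have a := (hF i).norm_gradient_sub_sq_le_norm_sub_sq hL z y
    have b : ‖gradient (F i) z - gradient (F i) y₀‖ ≤ ‖gradient (F i) z - gradient (F i) y‖ +
        ‖gradient (F i) y - gradient (F i) w‖ + ‖gradient (F i) y₀ - gradient (F i) w‖ := by
      have : gradient (F i) z - gradient (F i) y₀ = (gradient (F i) z - gradient (F i) y) +
        (gradient (F i) y - gradient (F i) w) - (gradient (F i) y₀ - gradient (F i) w) := by abel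
      rw [this]
      exact (norm_sub_le _ _).trans (by gcongr; exact norm_add_le _ _)
    have c := pow_le_pow_left₀ (norm_nonneg _) b 2
    nlinarith [sq_nonneg (‖gradient (F i) z - gradient (F i) y‖ -
        ‖gradient (F i) y - gradient (F i) w‖),
      sq_nonneg (‖gradient (F i) z - gradient (F i) y‖ - ‖gradient (F i) y₀ - gradient (F i) w‖),
      sq_nonneg (‖gradient (F i) y - gradient (F i) w‖ - ‖gradient (F i) y₀ - gradient (F i) w‖)]
  have h4 := mul_le_mul_of_nonneg_left h3 (by positivity : 0 ≤ 1 / (n : ℝ))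
  rw [← Finset.mul_sum, Finset.sum_add_distrib, Finset.sum_add_distrib, Finset.sum_const,
    Finset.card_univ, Fintype.card_fin, nsmul_eq_mul] at h4
  have h5 : 1 / (n : ℝ) * ((n : ℝ) * (L ^ 2 * ‖z - y‖ ^ 2)) = L ^ 2 * ‖z - y‖ ^ 2 := by
    field_simp
  nlinarith

/-- The initial point is at most `L D² / 2` away from optimality. -/
theorem IsLinearArgmin.objective_sub_le {K : Set (Vec d)} (hK : IsCompact K) {f : Vec d → ℝ}
    (hL : 0 < L) (hf : IsConvexSmooth L f) {x w₀ w : Vec d} (hx : x ∈ K) (hw : w ∈ K)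
    (hw₀ : IsLinearArgmin K (gradient f x) w₀) : f w₀ - f w ≤ L * Metric.diam K ^ 2 / 2 := by
  have h1 := hf.upper w₀ x
  have h2 := hf.lower w x
  have h3 := hw₀.2 w hw
  have h4 : ‖w₀ - x‖ ≤ Metric.diam K := by
    rw [← dist_eq_norm]; exact Metric.dist_le_diam_of_mem hK.isBounded hw₀.1 hx
  have h5 := pow_le_pow_left₀ (norm_nonneg _) h4 2
  rw [inner_sub_right] at h1 h2
  nlinarith

/-- Quadratic growth of a strongly convex function at a constrained minimizer. -/
theorem IsStronglyConvex.norm_sub_sq_le {K : Set (Vec d)} (hK : Convex ℝ K) {f : Vec d → ℝ} {α : ℝ}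
    (hf : IsConvexSmooth L f) (hα : IsStronglyConvex K α f) {w u : Vec d} (hw : w ∈ K)
    (hu : u ∈ K) (hmin : ∀ u ∈ K, f w ≤ f u) : α / 2 * ‖u - w‖ ^ 2 ≤ f u - f w := by
  have h1 := hα w hw u hu
  have h2 := inner_gradient_nonneg_of_isMinOn hK hf hw hmin hu
  rw [← neg_sub u w, inner_neg_right, norm_neg] at h1
  linarith

/-- A strong convexity constant is at most the smoothness constant. -/
theorem IsStronglyConvex.le_of_ne {K : Set (Vec d)} {f : Vec d → ℝ} {α : ℝ}
    (hf : IsConvexSmooth L f) (hα : IsStronglyConvex K α f) {w u : Vec d} (hw : w ∈ K)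
    (hu : u ∈ K) (hne : u ≠ w) : α ≤ L := by
  have h1 := hα w hw u hu
  have h2 := hf.upper u w
  rw [← neg_sub u w, inner_neg_right, norm_neg] at h1
  have h3 : 0 < ‖u - w‖ ^ 2 := by have := norm_pos_iff.2 (sub_ne_zero.2 hne); positivity
  by_contra hlt
  push Not at hlt
  nlinarith

end Deterministic

/-! ### Averaging over a uniform index independent of the past. -/

section FreshIndex

variable {ι : Type*} {n : ℕ} {S : Type*} [MeasurableSpace S] {P : Measure S}

/-- The factor `h` lives on the finite discrete type `T → Fin n`, which is why measurability and
boundedness come for free. -/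
theorem exists_restrict_of_dependsOn {E : Type*} [Nonempty E] {T : Finset ι}
    {Z : (ι → Fin n) → E} (hZ : DependsOn Z (T : Set ι)) :
    ∃ h : (T → Fin n) → E, ∀ a, Z a = h fun i => a i := by
  obtain ⟨h, hh⟩ := dependsOn_iff_exists_comp.1 hZ
  exact ⟨h, fun a => congrFun hh a⟩

/-- A function of finitely many random indices is integrable. -/
theorem integrable_of_dependsOn [IsFiniteMeasure P] {X : S → ι → Fin n}
    (hX : ∀ s, Measurable fun ω => X ω s) {T : Set ι} (hT : T.Finite) {Z : (ι → Fin n) → ℝ}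
    (hZ : DependsOn Z T) : Integrable (fun ω => Z (X ω)) P := by
  lift T to Finset ι using hT
  obtain ⟨h, hh⟩ := exists_restrict_of_dependsOn hZ
  simp only [hh]
  have hm : Measurable fun ω => fun i : T => X ω i := measurable_pi_lambda _ fun i => hX i
  obtain ⟨C, hC⟩ := (Set.finite_range fun p => ‖h p‖).bddAbove
  exact Integrable.of_bound ((Measurable.of_discrete (f := h)).comp hm).aestronglyMeasurable C
    (ae_of_all _ fun ω => hC ⟨_, rfl⟩)

/-- Averaging over a uniform index which is independent of the past. -/
theorem integral_fresh_index [IsProbabilityMeasure P] {X : S → ι → Fin n}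
    (hX : ∀ s, Measurable fun ω => X ω s) (hind : iIndepFun (fun s ω => X ω s) P)
    (hunif : ∀ s i, P {ω | X ω s = i} = (n : ENNReal)⁻¹) {T : Set ι} (hT : T.Finite)
    {s : ι} (hs : s ∉ T) {Z : (ι → Fin n) → Fin n → ℝ} (hZ : DependsOn Z T) :
    ∫ ω, Z (X ω) (X ω s) ∂P = ∫ ω, (1 / (n : ℝ)) * ∑ i, Z (X ω) i ∂P := by
  classical
  have hint : ∀ i, Integrable (fun ω => Z (X ω) i) P := fun i =>
    integrable_of_dependsOn hX hT (fun a b hab => congrFun (hZ hab) i)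
  have hind1 : ∀ i, Measurable fun ω => if X ω s = i then (1 : ℝ) else 0 := fun i =>
    (Measurable.of_discrete (f := fun k : Fin n => if k = i then (1 : ℝ) else 0)).comp (hX s)
  have hmul : ∀ i, ∫ ω, Z (X ω) i * (if X ω s = i then (1 : ℝ) else 0) ∂P =
      (∫ ω, Z (X ω) i ∂P) * (1 / (n : ℝ)) := by
    intro i
    have hindep : IndepFun (fun ω => Z (X ω) i) (fun ω => if X ω s = i then (1 : ℝ) else 0) P := by
      lift T to Finset ι using hT
      obtain ⟨h, hh⟩ := exists_restrict_of_dependsOn (Z := fun a => Z a i)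
        (fun a b hab => congrFun (hZ hab) i)
      have h0 := hind.indepFun_finset T {s} (by simpa using hs) hX
      have h1 := h0.comp (Measurable.of_discrete (f := h))
        (Measurable.of_discrete (f := fun p : ({s} : Finset ι) → Fin n =>
          if p ⟨s, Finset.mem_singleton_self s⟩ = i then (1 : ℝ) else 0))
      have e : (fun ω => Z (X ω) i) = h ∘ fun ω (i : T) => X ω i := funext fun ω => hh (X ω)
      rw [e]
      exact h1
    rw [hindep.integral_fun_mul_eq_mul_integral (hint i).aestronglyMeasurable
      (hind1 i).aestronglyMeasurable]
    congr 1
    have : (fun ω => if X ω s = i then (1 : ℝ) else 0) = {ω | X ω s = i}.indicator 1 := by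
      ext ω; simp [Set.indicator_apply]
    rw [this, integral_indicator_one (s := {ω | X ω s = i}) (hX s (measurableSet_singleton i)),
      measureReal_def, hunif]
    simp
  have hint2 : ∀ i, Integrable (fun ω => Z (X ω) i * (if X ω s = i then (1 : ℝ) else 0)) P :=
    fun i => (hint i).mul_bdd (c := 1) (hind1 i).aestronglyMeasurable
      (ae_of_all _ fun ω => by split_ifs <;> simp)
  -- Splitting over the value of the fresh index gives products of a function of the past with an
  -- independent indicator of mean 1/n.
  have e : ∀ ω, Z (X ω) (X ω s) = ∑ i, Z (X ω) i * (if X ω s = i then (1 : ℝ) else 0) := fun ω => by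
    simp
  simp only [e]
  rw [integral_finsetSum _ fun i _ => hint2 i, integral_const_mul,
    integral_finsetSum _ fun i _ => hint i, Finset.mul_sum]
  exact Finset.sum_congr rfl fun i _ => by rw [hmul, mul_comm]

variable {E : Type*} [NormedAddCommGroup E] [InnerProductSpace ℝ E]

/-- Centered noise driven by a fresh index is orthogonal to the past. -/
theorem integral_inner_fresh_index_eq_zero [IsProbabilityMeasure P] {X : S → ι → Fin n}
    (hX : ∀ s, Measurable fun ω => X ω s) (hind : iIndepFun (fun s ω => X ω s) P)
    (hunif : ∀ s i, P {ω | X ω s = i} = (n : ENNReal)⁻¹) {T : Set ι} (hT : T.Finite)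
    {s : ι} (hs : s ∉ T) {ψ : (ι → Fin n) → Fin n → E} (hψ : DependsOn ψ T)
    (h0 : ∀ a, ∑ i, ψ a i = 0) {c : (ι → Fin n) → E} (hc : DependsOn c T) :
    ∫ ω, inner ℝ (ψ (X ω) (X ω s)) (c (X ω)) ∂P = 0 := by
  rw [integral_fresh_index hX hind hunif hT hs (Z := fun a i => inner ℝ (ψ a i) (c a))
    (fun a b hab => by simp only [hψ hab, hc hab])]
  simp [← sum_inner, h0]

/-- The average of a batch of centered noise terms is orthogonal to the past. -/
theorem integral_inner_batch_eq_zero [IsProbabilityMeasure P] {X : S → ι → Fin n}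
    (hX : ∀ s, Measurable fun ω => X ω s) (hind : iIndepFun (fun s ω => X ω s) P)
    (hunif : ∀ s i, P {ω | X ω s = i} = (n : ENNReal)⁻¹) {T : Set ι} (hT : T.Finite)
    {s : ℕ → ι} (hs : ∀ j, s j ∉ T) {ψ : (ι → Fin n) → Fin n → E}
    (hψ : DependsOn ψ T) (h0 : ∀ a, ∑ i, ψ a i = 0) {c : (ι → Fin n) → E} (hc : DependsOn c T)
    (m : ℕ) :
    ∫ ω, inner ℝ ((1 / (m : ℝ)) • ∑ j ∈ Finset.range m, ψ (X ω) (X ω (s j))) (c (X ω)) ∂P = 0 := by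
  simp only [inner_smul_left, sum_inner]
  rw [integral_const_mul, integral_finsetSum]
  · rw [Finset.sum_eq_zero, mul_zero]
    exact fun j _ => integral_inner_fresh_index_eq_zero hX hind hunif hT (hs j) hψ h0 hc
  · intro j _
    refine integrable_of_dependsOn hX (hT.insert (s j))
      (Z := fun a => inner ℝ (ψ a (a (s j))) (c a)) fun a b hab => ?_
    simp only [hψ fun i hi => hab i (Or.inr hi), hc fun i hi => hab i (Or.inr hi),
      hab (s j) (Or.inl rfl)]

/-- The variance of the average of a batch of `m` centered noise terms. -/
theorem integral_norm_batch_sq [IsProbabilityMeasure P] {X : S → ι → Fin n}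
    (hX : ∀ s, Measurable fun ω => X ω s) (hind : iIndepFun (fun s ω => X ω s) P)
    (hunif : ∀ s i, P {ω | X ω s = i} = (n : ENNReal)⁻¹) {T : Set ι} (hT : T.Finite)
    {s : ℕ → ι} (hinj : Function.Injective s) (hs : ∀ j, s j ∉ T) {ψ : (ι → Fin n) → Fin n → E}
    (hψ : DependsOn ψ T) (h0 : ∀ a, ∑ i, ψ a i = 0) (m : ℕ) :
    ∫ ω, ‖(1 / (m : ℝ)) • ∑ j ∈ Finset.range m, ψ (X ω) (X ω (s j))‖ ^ 2 ∂P =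
      (1 / (m : ℝ)) * ∫ ω, (1 / (n : ℝ)) * ∑ i, ‖ψ (X ω) i‖ ^ 2 ∂P := by
  have e : ∀ ω, ‖(1 / (m : ℝ)) • ∑ j ∈ Finset.range m, ψ (X ω) (X ω (s j))‖ ^ 2 =
      (1 / (m : ℝ)) ^ 2 * ∑ j ∈ Finset.range m, ∑ l ∈ Finset.range m,
        inner ℝ (ψ (X ω) (X ω (s j))) (ψ (X ω) (X ω (s l))) := fun ω => by
    rw [norm_smul, mul_pow, Real.norm_eq_abs, sq_abs, ← real_inner_self_eq_norm_sq, sum_inner]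
    simp only [inner_sum]
  have hint : ∀ j l, Integrable (fun ω => inner ℝ (ψ (X ω) (X ω (s j))) (ψ (X ω) (X ω (s l)))) P := by
    intro j l
    refine integrable_of_dependsOn hX ((hT.insert (s l)).insert (s j))
      (Z := fun a => inner ℝ (ψ a (a (s j))) (ψ a (a (s l)))) fun a b hab => ?_
    simp only [hψ fun i hi => hab i (Or.inr (Or.inr hi)), hab (s j) (Or.inl rfl),
      hab (s l) (Or.inr (Or.inl rfl))]
  have hoff : ∀ j l, j ≠ l → ∫ ω, inner ℝ (ψ (X ω) (X ω (s j))) (ψ (X ω) (X ω (s l))) ∂P = 0 := by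
    intro j l hjl
    -- The index at `s l` is counted as past, so the one at `s j` is still fresh.
    refine integral_inner_fresh_index_eq_zero hX hind hunif (hT.insert (s l)) (s := s j)
      (fun h => h.elim (fun h => hjl (hinj h)) (hs j)) (hψ.mono (Set.subset_insert _ _)) h0
      (c := fun a => ψ a (a (s l))) fun a b hab => ?_
    simp only [hψ fun i hi => hab i (Or.inr hi), hab (s l) (Or.inl rfl)]
  have hdiag : ∀ j, ∫ ω, inner ℝ (ψ (X ω) (X ω (s j))) (ψ (X ω) (X ω (s j))) ∂P =
      ∫ ω, (1 / (n : ℝ)) * ∑ i, ‖ψ (X ω) i‖ ^ 2 ∂P := by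
    intro j
    simp only [real_inner_self_eq_norm_sq]
    exact integral_fresh_index hX hind hunif hT (hs j) (Z := fun a i => ‖ψ a i‖ ^ 2)
      fun a b hab => by simp only [hψ hab]
  simp only [e]
  rw [integral_const_mul, integral_finsetSum _ fun j _ => integrable_finsetSum _ fun l _ => hint j l]
  have : ∀ j ∈ Finset.range m, ∫ ω, ∑ l ∈ Finset.range m,
      inner ℝ (ψ (X ω) (X ω (s j))) (ψ (X ω) (X ω (s l))) ∂P =
      ∫ ω, (1 / (n : ℝ)) * ∑ i, ‖ψ (X ω) i‖ ^ 2 ∂P := by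
    intro j hj
    rw [integral_finsetSum _ fun l _ => hint j l, Finset.sum_eq_single_of_mem j hj
      fun l _ hl => hoff j l hl.symm, hdiag]
  rw [Finset.sum_congr rfl this, Finset.sum_const, Finset.card_range, nsmul_eq_mul]
  rcases Nat.eq_zero_or_pos m with rfl | hm
  · simp
  · have : (0 : ℝ) < m := by exact_mod_cast hm
    field_simp

end FreshIndex

/-! ### Which sampled indices the iterates depend on, and feasibility of the iterates. -/

section Dependence

variable {d n : ℕ}

/-- The indices sampled up to and including inner iteration `k` of outer iteration `t`. -/
def usedIndices (p : Params) (t k : ℕ) : Set (ℕ × ℕ × ℕ) :=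
  {s | s.2.2 < p.m s.1 s.2.1 ∧ ((s.1 < t ∧ s.2.1 ≤ p.N s.1) ∨ (s.1 = t ∧ s.2.1 ≤ k))}

theorem finite_usedIndices (p : Params) (t k : ℕ) : (usedIndices p t k).Finite := by
  have h : (⋃ t' ∈ Set.Iic t, ⋃ k' ∈ Set.Iic (max (p.N t') k), ⋃ j ∈ Set.Iio (p.m t' k'),
      {((t', k', j) : ℕ × ℕ × ℕ)}).Finite :=
    (Set.finite_Iic t).biUnion fun t' _ => (Set.finite_Iic _).biUnion fun k' _ =>
      (Set.finite_Iio _).biUnion fun j _ => Set.finite_singleton _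
  refine h.subset ?_
  rintro ⟨t', k', j⟩ ⟨hj, h⟩
  simp only [Set.mem_iUnion, Set.mem_Iic, Set.mem_Iio, Set.mem_singleton_iff, exists_prop]
  refine ⟨t', ?_, k', ?_, j, hj, rfl⟩
  · rcases h with h | h
    · exact h.1.le
    · exact h.1.le
  · rcases h with h | h
    · exact le_max_of_le_left h.2
    · exact le_max_of_le_right h.2

theorem usedIndices_mono (p : Params) (t : ℕ) {k k' : ℕ} (h : k ≤ k') :
    usedIndices p t k ⊆ usedIndices p t k' := fun _ hs =>
  ⟨hs.1, hs.2.imp id fun h' => ⟨h'.1, h'.2.trans h⟩⟩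

theorem notMem_usedIndices (p : Params) (t k j : ℕ) : (t, k + 1, j) ∉ usedIndices p t k := by
  rintro ⟨-, h | h⟩
  · exact lt_irrefl _ h.1
  · exact absurd h.2 (by simp)

theorem innerLoop_succ_snd (F : Fin n → Vec d → ℝ) (p : Params)
    (solver : ℕ → ℕ → Vec d → Vec d → Vec d) (t : ℕ) (y₀ : Vec d) (idx : ℕ → ℕ → Fin n) (k : ℕ) :
    (innerLoop F p solver t y₀ idx (k + 1)).2 =
      (1 - p.γ (k + 1)) • (innerLoop F p solver t y₀ idx k).2 +
        p.γ (k + 1) • (innerLoop F p solver t y₀ idx (k + 1)).1 := rfl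

/-- The solver is deterministic, so inner iteration k + 1 only adds dependence on its own batch. The
triples (t, 0, j) in `usedIndices p t 0` are never drawn; that set stands for the information
available when outer iteration t starts. -/
theorem dependsOn_innerLoop (F : Fin n → Vec d → ℝ) (p : Params)
    (solver : ℕ → ℕ → Vec d → Vec d → Vec d) {t : ℕ} {w : (ℕ × ℕ × ℕ → Fin n) → Vec d}
    (hw : DependsOn w (usedIndices p t 0)) (k : ℕ) :
    DependsOn (fun a => innerLoop F p solver t (w a) (fun k j => a (t, k, j)) k)
      (usedIndices p t k) := by
  induction k with
  | zero => intro a b hab; simp only [innerLoop, hw hab]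
  | succ k ih =>
    intro a b hab
    have h1 := ih fun s hs => hab s (usedIndices_mono p t k.le_succ hs)
    have h2 := hw fun s hs => hab s (usedIndices_mono p t (Nat.zero_le _) hs)
    have h3 : ∀ z y, batchGrad F (p.m t (k + 1)) z y (fun j => a (t, k + 1, j)) =
        batchGrad F (p.m t (k + 1)) z y (fun j => b (t, k + 1, j)) := by
      intro z y
      unfold batchGrad
      congr 1
      refine Finset.sum_congr rfl fun j hj => ?_
      exact congrArg _ (hab (t, k + 1, j) ⟨Finset.mem_range.1 hj, Or.inr ⟨rfl, le_rfl⟩⟩)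
    simp only [h2] at h1 ⊢
    simp only [innerLoop, h1, h3]

theorem dependsOn_iterate (F : Fin n → Vec d → ℝ) (p : Params)
    (solver : ℕ → ℕ → Vec d → Vec d → Vec d) (w₀ : Vec d) (t : ℕ) :
    DependsOn (fun a : ℕ × ℕ × ℕ → Fin n => iterate F p solver w₀ (fun t k j => a (t, k, j)) t)
      (usedIndices p (t + 1) 0) := by
  induction t with
  | zero => exact fun a b _ => rfl
  | succ t ih =>
    intro a b hab
    have h := dependsOn_innerLoop F p solver ih (p.N (t + 1)) (x := a) (y := b) fun s hs => by
      refine hab s ⟨hs.1, Or.inl ?_⟩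
      rcases hs.2 with h | h
      · exact ⟨by omega, h.2⟩
      · exact ⟨by omega, by rw [h.1]; exact h.2⟩
    simp only at h
    simp only [iterate, h]

theorem innerLoop_mem {K : Set (Vec d)} (hK : Convex ℝ K) (F : Fin n → Vec d → ℝ) {p : Params}
    (hγ : ∀ k, p.γ (k + 1) ∈ Set.Icc (0 : ℝ) 1) {solver : ℕ → ℕ → Vec d → Vec d → Vec d}
    (hsolver : IsFrankWolfeSolver K p solver) {t : ℕ} (ht : 1 ≤ t) {y₀ : Vec d} (hy₀ : y₀ ∈ K)
    (idx : ℕ → ℕ → Fin n) {k : ℕ} (hk : k ≤ p.N t) :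
    (innerLoop F p solver t y₀ idx k).1 ∈ K ∧ (innerLoop F p solver t y₀ idx k).2 ∈ K := by
  induction k with
  | zero => exact ⟨hy₀, hy₀⟩
  | succ k ih =>
    obtain ⟨hx, hy⟩ := ih (by omega)
    have hx' : (innerLoop F p solver t y₀ idx (k + 1)).1 ∈ K :=
      (hsolver t (k + 1) ht (by omega) hk _ hx _).mem hK
    refine ⟨hx', ?_⟩
    rw [innerLoop_succ_snd]
    exact hK hy hx' (by linarith [(hγ k).2]) (hγ k).1 (by ring)

theorem iterate_mem {K : Set (Vec d)} (hK : Convex ℝ K) (F : Fin n → Vec d → ℝ) {p : Params}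
    (hγ : ∀ k, p.γ (k + 1) ∈ Set.Icc (0 : ℝ) 1) {solver : ℕ → ℕ → Vec d → Vec d → Vec d}
    (hsolver : IsFrankWolfeSolver K p solver) {w₀ : Vec d} (hw₀ : w₀ ∈ K)
    (idx : ℕ → ℕ → ℕ → Fin n) (t : ℕ) : iterate F p solver w₀ idx t ∈ K := by
  induction t with
  | zero => exact hw₀
  | succ t ih => exact (innerLoop_mem hK F hγ hsolver (by omega) ih _ le_rfl).2

theorem params_γ_mem (L : ℝ) (Dt : ℕ → ℝ) (N : ℕ → ℕ) (m : ℕ → ℕ → ℕ) (k : ℕ) :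
    (params L Dt N m).γ (k + 1) ∈ Set.Icc (0 : ℝ) 1 := by
  simp only [params, Set.mem_Icc]
  push_cast
  have : (0 : ℝ) ≤ k := k.cast_nonneg
  refine ⟨by positivity, ?_⟩
  rw [div_le_one (by positivity)]
  linarith

end Dependence

/-! ### Pathwise progress of one inner iteration. -/

section InnerLoop

variable {d n : ℕ} {L : ℝ}

/-- Progress of one inner iteration, in terms of the potential
`k (k + 1) (f y_k - f w) + 3 L ‖x_k - w‖²`. -/
theorem innerLoop_potential_le (hL : 0 < L) {K : Set (Vec d)} (hK : Convex ℝ K)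
    {F : Fin n → Vec d → ℝ} (hf : IsConvexSmooth L (objective F)) {w : Vec d} (hw : w ∈ K)
    {Dt : ℕ → ℝ} {N : ℕ → ℕ} {m : ℕ → ℕ → ℕ} {solver : ℕ → ℕ → Vec d → Vec d → Vec d}
    (hsolver : IsFrankWolfeSolver K (params L Dt N m) solver) {t : ℕ} (ht : 1 ≤ t) {y₀ : Vec d}
    (hy₀ : y₀ ∈ K) (idx : ℕ → ℕ → Fin n) {k : ℕ} (hk : k + 1 ≤ N t) {x y x' y' z δ : Vec d}
    (hx : x = (innerLoop F (params L Dt N m) solver t y₀ idx (k + 1)).1)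
    (hy : y = (innerLoop F (params L Dt N m) solver t y₀ idx (k + 1)).2)
    (hx' : x' = (innerLoop F (params L Dt N m) solver t y₀ idx k).1)
    (hy' : y' = (innerLoop F (params L Dt N m) solver t y₀ idx k).2)
    (hz : z = (1 - (params L Dt N m).γ (k + 1)) • y' + (params L Dt N m).γ (k + 1) • x')
    (hδ : δ = batchGrad F (m t (k + 1)) z y₀ (idx (k + 1)) - gradient (objective F) z) :
    ((k + 1 : ℝ) * (k + 2)) * (objective F y - objective F w) + 3 * L * ‖x - w‖ ^ 2 ≤
      (k * (k + 1 : ℝ)) * (objective F y' - objective F w) + 3 * L * ‖x' - w‖ ^ 2 +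
        4 * L * Dt t ^ 2 / N t + (k + 1 : ℝ) ^ 2 / L * ‖δ‖ ^ 2 -
        2 * (k + 1) * inner ℝ δ (x' - w) := by
  have hNpos : (0 : ℝ) < N t := by exact_mod_cast (by omega : 0 < N t)
  have hk0 : (0 : ℝ) ≤ k := k.cast_nonneg
  have hx'K : x' ∈ K := by
    rw [hx']
    exact (innerLoop_mem hK F (params_γ_mem L Dt N m) hsolver ht hy₀ idx
      (by change k ≤ N t; omega)).1
  have hgap := (hsolver t (k + 1) ht (by omega) hk x' hx'K
    (batchGrad F (m t (k + 1)) z y₀ (idx (k + 1)))).dualityGapLE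
  have hxe : x = solver t (k + 1) x' (batchGrad F (m t (k + 1)) z y₀ (idx (k + 1))) := by
    rw [hx, hz, hx', hy']; rfl
  have hye : y = (1 - (params L Dt N m).γ (k + 1)) • y' + (params L Dt N m).γ (k + 1) • x := by
    rw [hy, hx, hy']; rfl
  rw [← hxe] at hgap
  have hγe : (params L Dt N m).γ (k + 1) = 2 / ((k : ℝ) + 2) := by
    simp only [params]; push_cast; ring
  have hβe : (params L Dt N m).β (k + 1) = 3 * L / ((k : ℝ) + 1) := by
    simp only [params]; push_cast; rfl
  have hηe : (params L Dt N m).η t (k + 1) = 2 * L * Dt t ^ 2 / (N t * ((k : ℝ) + 1)) := by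
    simp only [params]; push_cast; rfl
  -- The inner iteration is number k + 1; the factor 3 in β leaves at least L/(k+1) for absorbing
  -- the noise.
  have hβγ : L / ((k : ℝ) + 1) ≤ 3 * L / ((k : ℝ) + 1) - L * (2 / ((k : ℝ) + 2)) := by
    have : 3 * L / ((k : ℝ) + 1) - L * (2 / ((k : ℝ) + 2)) - L / ((k : ℝ) + 1) =
        2 * L / (((k : ℝ) + 1) * (k + 2)) := by field_simp; ring
    have : 0 ≤ 2 * L / (((k : ℝ) + 1) * (k + 2)) := by positivity
    linarith
  have hpos : 0 < L / ((k : ℝ) + 1) := by positivity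
  obtain ⟨hγ0, hγ1⟩ := params_γ_mem L Dt N m k
  have hstep := hf.accelerated_step hγ0 hγ1 (by rw [hγe, hβe]; linarith) hw hz hgap
  rw [← hye, ← hδ, hγe, hβe, hηe] at hstep
  -- This factor turns 1 - γ into k(k+1) and γβ/2 into the constant 3L, so both parts of the
  -- potential telescope.
  have hstep' := mul_le_mul_of_nonneg_left hstep
    (by positivity : 0 ≤ ((k : ℝ) + 1) * (k + 2))
  have hδle : ‖δ‖ ^ 2 / (2 * (3 * L / ((k : ℝ) + 1) - L * (2 / ((k : ℝ) + 2)))) ≤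
      ((k : ℝ) + 1) / (2 * L) * ‖δ‖ ^ 2 := by
    calc _ ≤ ‖δ‖ ^ 2 / (2 * (L / ((k : ℝ) + 1))) := by gcongr
      _ = _ := by field_simp
  set Q := ‖δ‖ ^ 2 / (2 * (3 * L / ((k : ℝ) + 1) - L * (2 / ((k : ℝ) + 2))))
  have e : ((k : ℝ) + 1) * (k + 2) * ((1 - 2 / ((k : ℝ) + 2)) * (objective F y' - objective F w) +
      2 / ((k : ℝ) + 2) * (2 * L * Dt t ^ 2 / (N t * ((k : ℝ) + 1)) +
        3 * L / ((k : ℝ) + 1) / 2 * (‖x' - w‖ ^ 2 - ‖x - w‖ ^ 2) + Q - inner ℝ δ (x' - w))) =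
      (k * (k + 1 : ℝ)) * (objective F y' - objective F w) + 4 * L * Dt t ^ 2 / N t +
        3 * L * (‖x' - w‖ ^ 2 - ‖x - w‖ ^ 2) + 2 * (k + 1) * Q -
        2 * (k + 1) * inner ℝ δ (x' - w) := by
    field_simp
    ring
  rw [e] at hstep'
  have h5 := mul_le_mul_of_nonneg_left hδle (by positivity : 0 ≤ 2 * ((k : ℝ) + 1))
  have e2 : 2 * ((k : ℝ) + 1) * (((k : ℝ) + 1) / (2 * L) * ‖δ‖ ^ 2) =
      (k + 1 : ℝ) ^ 2 / L * ‖δ‖ ^ 2 := by field_simp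
  linarith

/-- An empty batch would give the zero vector instead of an unbiased estimate, hence `0 < m`. -/
theorem batchGrad_sub_eq (F : Fin n → Vec d → ℝ) {m : ℕ} (hm : 0 < m) (z y : Vec d)
    (idx : ℕ → Fin n) : batchGrad F m z y idx - gradient (objective F) z =
      (1 / (m : ℝ)) • ∑ j ∈ Finset.range m,
        (vrGrad F z y (idx j) - gradient (objective F) z) := by
  have hm' : (0 : ℝ) < m := by exact_mod_cast hm
  rw [batchGrad, Finset.sum_sub_distrib, smul_sub, Finset.sum_const, Finset.card_range,
    ← Nat.cast_smul_eq_nsmul ℝ, smul_smul, one_div_mul_cancel hm'.ne', one_smul]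

/-- Convexity of the squared norm; it passes the distance bound from the x_k to their averages y_k.
-/
theorem norm_combination_sub_sq_le {γ : ℝ} (h0 : 0 ≤ γ) (h1 : γ ≤ 1) (x y w : Vec d) :
    ‖(1 - γ) • y + γ • x - w‖ ^ 2 ≤ (1 - γ) * ‖y - w‖ ^ 2 + γ * ‖x - w‖ ^ 2 := by
  have e : (1 - γ) • y + γ • x - w = (1 - γ) • (y - w) + γ • (x - w) := by module
  rw [e, norm_add_sq_real, norm_smul, norm_smul, inner_smul_left, inner_smul_right, mul_pow,
    mul_pow, Real.norm_eq_abs, Real.norm_eq_abs, sq_abs, sq_abs]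
  simp only [conj_trivial]
  have h2 : 2 * inner ℝ (y - w) (x - w) ≤ ‖y - w‖ ^ 2 + ‖x - w‖ ^ 2 := by
    have := norm_sub_sq_real (y - w) (x - w)
    have := sq_nonneg ‖(y - w) - (x - w)‖
    linarith
  have h3 := mul_le_mul_of_nonneg_left h2 (mul_nonneg (by linarith : 0 ≤ 1 - γ) h0)
  nlinarith

end InnerLoop

/-! ### Expected progress of one outer iteration. -/

section Expectation

variable {d n : ℕ} {L : ℝ}

/-- The arithmetic behind the variance bound in inner iteration `κ + 1`. -/
theorem scaled_variance_le {L κ A B C a V D₂ : ℝ} (hL : 0 < L) (hκ : 1 ≤ κ) (hA : 0 ≤ A)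
    (hB : 0 ≤ B) (hC : 0 ≤ C) (hpot : κ * (κ + 1) * A + 3 * L * B ≤ 8 * (L * D₂))
    (hCle : C ≤ 8 / 3 * D₂) (ha : (κ + 1) ^ 2 * a ≤ 30 * (L * D₂))
    (hV : V ≤ 3 * (L ^ 2 * ((2 / (κ + 2)) ^ 2 * (2 * B + 2 * C)) + 2 * L * A + 2 * L * a)) :
    (κ + 1) ^ 2 * V ≤ 700 * L ^ 2 * D₂ := by
  have hBle : B ≤ 8 / 3 * D₂ := by
    have h0 : 0 ≤ κ * (κ + 1) * A := by positivity
    have h1 : L * (3 * B) ≤ L * (8 * D₂) := by linarith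
    have h2 := le_of_mul_le_mul_left h1 hL
    linarith
  have hAle : (κ + 1) ^ 2 * A ≤ 16 * (L * D₂) := by
    -- This uses κ ≥ 1; the first inner iteration is treated apart.
    have h1 : (κ + 1) ^ 2 * A ≤ 2 * (κ * (κ + 1)) * A := by
      gcongr; nlinarith
    have h2 : 0 ≤ 3 * L * B := by positivity
    linarith
  have hγle : (κ + 1) ^ 2 * (2 / (κ + 2)) ^ 2 ≤ 4 := by
    have h1 : (κ + 1) * (2 / (κ + 2)) ≤ 2 := by
      rw [mul_div_assoc', div_le_iff₀ (by positivity)]; linarith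
    have h2 := pow_le_pow_left₀ (by positivity) h1 2
    rw [mul_pow] at h2
    linarith
  have hBC : (κ + 1) ^ 2 * (2 / (κ + 2)) ^ 2 * (2 * B + 2 * C) ≤ 4 * (32 / 3 * D₂) :=
    mul_le_mul hγle (by linarith) (by positivity) (by norm_num)
  have h1 := mul_le_mul_of_nonneg_left hV (by positivity : 0 ≤ (κ + 1) ^ 2)
  have h2 := mul_le_mul_of_nonneg_left hBC (by positivity : 0 ≤ L ^ 2)
  have h3 := mul_le_mul_of_nonneg_left hAle hL.le
  have h4 := mul_le_mul_of_nonneg_left ha hL.le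
  have h5 : 0 ≤ L ^ 2 * D₂ := by
    have : 0 ≤ D₂ := by linarith
    positivity
  -- The constants add up to 3(4·32/3 + 2·16 + 2·30) = 404, below 700.
  linarith

set_option maxHeartbeats 1000000 in
/-- The optimality gap after an outer iteration, given that its snapshot `w` is close to `wstar` in
mean square and nearly optimal in expectation. -/
theorem integral_innerLoop_le (hL : 0 < L) (hn : 0 < n) {K : Set (Vec d)} (hK : Convex ℝ K)
    {F : Fin n → Vec d → ℝ} (hF : ∀ i, IsConvexSmooth L (F i)) {wstar : Vec d} (hwstar : wstar ∈ K)
    (hmin : ∀ u ∈ K, objective F wstar ≤ objective F u)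
    {Dt : ℕ → ℝ} {N : ℕ → ℕ} {m : ℕ → ℕ → ℕ} {solver : ℕ → ℕ → Vec d → Vec d → Vec d}
    (hsolver : IsFrankWolfeSolver K (params L Dt N m) solver)
    {S : Type*} [MeasurableSpace S] {P : Measure S} [IsProbabilityMeasure P]
    {X : S → ℕ × ℕ × ℕ → Fin n} (hX : ∀ s, Measurable fun ω => X ω s)
    (hind : iIndepFun (fun s ω => X ω s) P)
    (hunif : ∀ s i, P {ω | X ω s = i} = (n : ENNReal)⁻¹)
    {t : ℕ} (ht : 1 ≤ t) (hN : 1 ≤ N t) (hm : ∀ k, 1 ≤ k → 700 * N t ≤ m t k)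
    {w : (ℕ × ℕ × ℕ → Fin n) → Vec d} (hw : DependsOn w (usedIndices (params L Dt N m) t 0))
    (hwK : ∀ a, w a ∈ K) (hdist : ∫ ω, ‖w (X ω) - wstar‖ ^ 2 ∂P ≤ Dt t ^ 2)
    {a₀ : ℝ} (hgap : ∫ ω, (objective F (w (X ω)) - objective F wstar) ∂P ≤ a₀)
    (ha₀ : ((N t : ℝ) + 1) ^ 2 * a₀ ≤ 30 * L * Dt t ^ 2) :
    (N t : ℝ) * (N t + 1) * ∫ ω, (objective F (innerLoop F (params L Dt N m) solver t (w (X ω))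
      (fun k j => X ω (t, k, j)) (N t)).2 - objective F wstar) ∂P ≤ 8 * L * Dt t ^ 2 := by
  set p := params L Dt N m with hp
  have hf := isConvexSmooth_objective hn hF
  have hNpos : (0 : ℝ) < N t := by exact_mod_cast hN
  set x : ℕ → (ℕ × ℕ × ℕ → Fin n) → Vec d := fun k a =>
    (innerLoop F p solver t (w a) (fun k j => a (t, k, j)) k).1 with hx
  set y : ℕ → (ℕ × ℕ × ℕ → Fin n) → Vec d := fun k a =>
    (innerLoop F p solver t (w a) (fun k j => a (t, k, j)) k).2 with hy
  have hxK : ∀ k ≤ N t, ∀ a, x k a ∈ K := fun k hk a =>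
    (innerLoop_mem hK F (params_γ_mem L Dt N m) hsolver ht (hwK a) _ hk).1
  have hyK : ∀ k ≤ N t, ∀ a, y k a ∈ K := fun k hk a =>
    (innerLoop_mem hK F (params_γ_mem L Dt N m) hsolver ht (hwK a) _ hk).2
  have hxd : ∀ k, DependsOn (x k) (usedIndices p t k) := fun k a b hab =>
    congrArg Prod.fst (dependsOn_innerLoop F p solver hw k hab)
  have hyd : ∀ k, DependsOn (y k) (usedIndices p t k) := fun k a b hab =>
    congrArg Prod.snd (dependsOn_innerLoop F p solver hw k hab)
  have hwd : ∀ k, DependsOn w (usedIndices p t k) := fun k =>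
    hw.mono (usedIndices_mono p t (Nat.zero_le k))
  have hfin := finite_usedIndices p t
  have hintA : ∀ k, Integrable (fun ω => objective F (y k (X ω)) - objective F wstar) P := fun k =>
    integrable_of_dependsOn hX (hfin k) (Z := fun a => objective F (y k a) - objective F wstar)
      fun a b hab => by simp only [hyd k hab]
  have hintW : Integrable (fun ω => objective F (w (X ω)) - objective F wstar) P :=
    integrable_of_dependsOn hX (hfin 0) (Z := fun a => objective F (w a) - objective F wstar)
      fun a b hab => by simp only [hw hab]
  have hintD : ∀ k, Integrable (fun ω => ‖x k (X ω) - wstar‖ ^ 2) P := fun k =>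
    integrable_of_dependsOn hX (hfin k) (Z := fun a => ‖x k a - wstar‖ ^ 2)
      fun a b hab => by simp only [hxd k hab]
  have hintE : ∀ k, Integrable (fun ω => ‖y k (X ω) - wstar‖ ^ 2) P := fun k =>
    integrable_of_dependsOn hX (hfin k) (Z := fun a => ‖y k a - wstar‖ ^ 2)
      fun a b hab => by simp only [hyd k hab]
  set A : ℕ → ℝ := fun k => ∫ ω, (objective F (y k (X ω)) - objective F wstar) ∂P with hA
  set B : ℕ → ℝ := fun k => ∫ ω, ‖x k (X ω) - wstar‖ ^ 2 ∂P with hB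
  set C : ℕ → ℝ := fun k => ∫ ω, ‖y k (X ω) - wstar‖ ^ 2 ∂P with hC
  have hA0 : ∀ k ≤ N t, 0 ≤ A k := fun k hk =>
    integral_nonneg fun ω => sub_nonneg.2 (hmin _ (hyK k hk _))
  have hB0 : ∀ k, 0 ≤ B k := fun k => integral_nonneg fun ω => by positivity
  have ha₀' : 0 ≤ a₀ := le_trans (integral_nonneg fun ω => sub_nonneg.2 (hmin _ (hwK _))) hgap
  -- Each step costs 4 units of L D_t²/N_t for the duality gap and 1 for the noise. Since k ≤ N_t,
  -- the total stays below 8 L D_t², which gives 8/3 for E‖x_k - w*‖² and, by averaging, for E‖y_k -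
  -- w*‖². The variance bound of the next step needs both parts.
  have key : ∀ k ≤ N t, (k : ℝ) * (k + 1) * A k + 3 * L * B k ≤
      3 * L * Dt t ^ 2 + 5 * k * (L * Dt t ^ 2 / N t) ∧ C k ≤ 8 / 3 * Dt t ^ 2 := by
    intro k
    induction k with
    | zero =>
      intro _
      have hB' : B 0 ≤ Dt t ^ 2 := hdist
      have hC' : C 0 ≤ Dt t ^ 2 := hdist
      refine ⟨?_, by nlinarith [sq_nonneg (Dt t)]⟩
      push_cast
      nlinarith
    | succ k ih =>
      intro hk
      obtain ⟨ih1, ih2⟩ := ih (by omega)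
      have hk0 : (0 : ℝ) ≤ k := k.cast_nonneg
      have hkN : (k : ℝ) + 1 ≤ N t := by exact_mod_cast hk
      have hQ : 0 ≤ L * Dt t ^ 2 / N t := by positivity
      have hQN : N t * (L * Dt t ^ 2 / N t) = L * Dt t ^ 2 := by field_simp
      set γ := p.γ (k + 1) with hγ
      obtain ⟨hγ0, hγ1⟩ : γ ∈ Set.Icc (0 : ℝ) 1 := params_γ_mem L Dt N m k
      have hγe : γ = 2 / ((k : ℝ) + 2) := by
        simp only [hγ, hp, params]; push_cast; ring
      set z : (ℕ × ℕ × ℕ → Fin n) → Vec d := fun a => (1 - γ) • y k a + γ • x k a with hz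
      set ψ : (ℕ × ℕ × ℕ → Fin n) → Fin n → Vec d := fun a i =>
        vrGrad F (z a) (w a) i - gradient (objective F) (z a) with hψ
      have hψd : DependsOn ψ (usedIndices p t k) := fun a b hab => by
        simp only [hψ, hz, hxd k hab, hyd k hab, hwd k hab]
      have hψ0 : ∀ a, ∑ i, ψ a i = 0 := fun a =>
        sum_vrGrad_sub_eq_zero hn (fun i => (hF i).differentiable) _ _
      have hmk := hm (k + 1) (by omega)
      have hmpos : 0 < m t (k + 1) := by omega
      have hmk' : 700 * (N t : ℝ) ≤ m t (k + 1) := by exact_mod_cast hmk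
      have hmpos' : (0 : ℝ) < m t (k + 1) := by exact_mod_cast hmpos
      set δ : (ℕ × ℕ × ℕ → Fin n) → Vec d := fun a =>
        (1 / (m t (k + 1) : ℝ)) • ∑ j ∈ Finset.range (m t (k + 1)), ψ a (a (t, k + 1, j)) with hδ
      have hinj : Function.Injective fun j : ℕ => (t, k + 1, j) := fun i j h => by simpa using h
      have hfresh := notMem_usedIndices p t k
      have hδd : DependsOn δ (usedIndices p t (k + 1)) := fun a b hab => by
        have h1 := hψd fun s hs => hab s (usedIndices_mono p t k.le_succ hs)
        simp only [hδ, h1]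
        congr 1
        refine Finset.sum_congr rfl fun j hj => ?_
        exact congrArg _ (hab (t, k + 1, j) ⟨Finset.mem_range.1 hj, Or.inr ⟨rfl, le_rfl⟩⟩)
      have horth : ∫ ω, inner ℝ (δ (X ω)) (x k (X ω) - wstar) ∂P = 0 :=
        integral_inner_batch_eq_zero hX hind hunif (hfin k) hfresh hψd hψ0
          (c := fun a => x k a - wstar) (fun a b hab => by simp only [hxd k hab]) _
      set V := ∫ ω, (1 / (n : ℝ)) * ∑ i, ‖ψ (X ω) i‖ ^ 2 ∂P with hV
      have hvar : ∫ ω, ‖δ (X ω)‖ ^ 2 ∂P = (1 / (m t (k + 1) : ℝ)) * V :=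
        integral_norm_batch_sq hX hind hunif (hfin k) hinj hfresh hψd hψ0 _
      have hVle : (k + 1 : ℝ) ^ 2 * V ≤ 700 * L ^ 2 * Dt t ^ 2 := by
        -- In the first inner iteration z is the snapshot itself, so the variance-reduced gradient
        -- is exact.
        rcases Nat.eq_zero_or_pos k with hk1 | hk1
        · have : V = 0 := by
            rw [hV]
            have hz0 : ∀ a, z a = w a := fun a => by
              simp only [hz, hy, hx, hk1, innerLoop]; module
            have : ∀ a i, ψ a i = 0 := fun a i => by
              simp only [hψ, hz0, vrGrad]; abel
            simp [this]
          rw [this, mul_zero]; positivity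
        · have hk1' : (1 : ℝ) ≤ k := by exact_mod_cast hk1
          have hintV : Integrable (fun ω => (1 / (n : ℝ)) * ∑ i, ‖ψ (X ω) i‖ ^ 2) P :=
            integrable_of_dependsOn hX (hfin k)
              (Z := fun a => (1 / (n : ℝ)) * ∑ i, ‖ψ a i‖ ^ 2)
              fun a b hab => by simp only [hψd hab]
          have hVb : V ≤ 3 * (L ^ 2 * (γ ^ 2 * (2 * B k + 2 * C k)) + 2 * L * A k +
              2 * L * ∫ ω, (objective F (w (X ω)) - objective F wstar) ∂P) := by
            have hint : Integrable (fun ω => 3 * (L ^ 2 * (γ ^ 2 * (2 * ‖x k (X ω) - wstar‖ ^ 2 +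
                2 * ‖y k (X ω) - wstar‖ ^ 2)) +
                2 * L * (objective F (y k (X ω)) - objective F wstar) +
                2 * L * (objective F (w (X ω)) - objective F wstar))) P :=
              (((((((hintD k).const_mul 2).add ((hintE k).const_mul 2)).const_mul _).const_mul
                _).add ((hintA k).const_mul _)).add (hintW.const_mul _)).const_mul _
            have h1 : V ≤ _ := integral_mono hintV hint fun ω => by
              have h2 := sum_norm_vrGrad_sub_sq_le_of_mem hL hn hK hF hwstar hmin
                (hyK k (by omega) (X ω)) (hwK (X ω)) (z (X ω))
              have h3 : z (X ω) - y k (X ω) =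
                  γ • ((x k (X ω) - wstar) - (y k (X ω) - wstar)) := by
                simp only [hz]; module
              have h4 : ‖z (X ω) - y k (X ω)‖ ^ 2 ≤ γ ^ 2 * (2 * ‖x k (X ω) - wstar‖ ^ 2 +
                  2 * ‖y k (X ω) - wstar‖ ^ 2) := by
                rw [h3, norm_smul, mul_pow, Real.norm_eq_abs, sq_abs]
                refine mul_le_mul_of_nonneg_left ?_ (sq_nonneg _)
                have h5 := pow_le_pow_left₀ (norm_nonneg _)
                  (norm_sub_le (x k (X ω) - wstar) (y k (X ω) - wstar)) 2
                nlinarith [sq_nonneg (‖x k (X ω) - wstar‖ - ‖y k (X ω) - wstar‖)]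
              refine h2.trans ?_
              gcongr
            refine h1.trans (le_of_eq ?_)
            rw [integral_const_mul, integral_add, integral_add, integral_const_mul,
              integral_const_mul, integral_const_mul, integral_const_mul, integral_add,
              integral_const_mul, integral_const_mul]
            · exact (hintD k).const_mul 2
            · exact (hintE k).const_mul 2
            · exact ((((hintD k).const_mul 2).add ((hintE k).const_mul 2)).const_mul _).const_mul _
            · exact (hintA k).const_mul _
            · exact (((((hintD k).const_mul 2).add ((hintE k).const_mul 2)).const_mul _).const_mul
                _).add ((hintA k).const_mul _)
            · exact hintW.const_mul _
          have hpot : (k : ℝ) * (k + 1) * A k + 3 * L * B k ≤ 8 * (L * Dt t ^ 2) := by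
            have : 5 * k * (L * Dt t ^ 2 / N t) ≤ 5 * (N t * (L * Dt t ^ 2 / N t)) := by
              rw [mul_assoc]; gcongr; linarith
            linarith
          have hale : (k + 1 : ℝ) ^ 2 * ∫ ω, (objective F (w (X ω)) - objective F wstar) ∂P ≤
              30 * (L * Dt t ^ 2) := by
            calc _ ≤ (k + 1 : ℝ) ^ 2 * a₀ := by gcongr
              _ ≤ ((N t : ℝ) + 1) ^ 2 * a₀ := by gcongr; linarith
              _ ≤ _ := by linarith
          exact scaled_variance_le hL hk1' (hA0 k (by omega)) (hB0 k)
            (integral_nonneg fun ω => by positivity) hpot ih2 hale (hγe ▸ hVb)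
      have hδle : (k + 1 : ℝ) ^ 2 / L * ∫ ω, ‖δ (X ω)‖ ^ 2 ∂P ≤ L * Dt t ^ 2 / N t := by
        have e1 : (k + 1 : ℝ) ^ 2 / L * ∫ ω, ‖δ (X ω)‖ ^ 2 ∂P =
            (k + 1 : ℝ) ^ 2 * V / (L * m t (k + 1)) := by rw [hvar]; field_simp
        rw [e1]
        calc _ ≤ 700 * L ^ 2 * Dt t ^ 2 / (L * (700 * N t)) := by gcongr
          _ = _ := by field_simp
      have hintδ : Integrable (fun ω => ‖δ (X ω)‖ ^ 2) P :=
        integrable_of_dependsOn hX (hfin (k + 1)) (Z := fun a => ‖δ a‖ ^ 2)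
          fun a b hab => by simp only [hδd hab]
      have hinti : Integrable (fun ω => inner ℝ (δ (X ω)) (x k (X ω) - wstar)) P :=
        integrable_of_dependsOn hX (hfin (k + 1)) (Z := fun a => inner ℝ (δ a) (x k a - wstar))
          fun a b hab => by
            simp only [hδd hab, hxd k fun s hs => hab s (usedIndices_mono p t k.le_succ hs)]
      have hstep : ∀ ω, ((k + 1 : ℝ) * (k + 2)) *
          (objective F (y (k + 1) (X ω)) - objective F wstar) +
          3 * L * ‖x (k + 1) (X ω) - wstar‖ ^ 2 ≤
          (k * (k + 1 : ℝ)) * (objective F (y k (X ω)) - objective F wstar) +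
            3 * L * ‖x k (X ω) - wstar‖ ^ 2 + 4 * L * Dt t ^ 2 / N t +
            (k + 1 : ℝ) ^ 2 / L * ‖δ (X ω)‖ ^ 2 -
            2 * (k + 1) * inner ℝ (δ (X ω)) (x k (X ω) - wstar) := fun ω =>
        innerLoop_potential_le hL hK hf hwstar hsolver ht (hwK (X ω))
          (fun k j => X ω (t, k, j)) hk rfl rfl rfl rfl rfl
          (batchGrad_sub_eq F hmpos _ _ _).symm
      have hi1 := ((hintA k).const_mul (k * (k + 1 : ℝ))).add ((hintD k).const_mul (3 * L))
      have hi2 := hi1.add (integrable_const (μ := P) (4 * L * Dt t ^ 2 / N t))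
      have hi3 := hi2.add (hintδ.const_mul ((k + 1 : ℝ) ^ 2 / L))
      have hi4 := hi3.sub (hinti.const_mul (2 * (k + 1 : ℝ)))
      have hl1 := (hintA (k + 1)).const_mul ((k + 1 : ℝ) * (k + 2))
      have hl2 := (hintD (k + 1)).const_mul (3 * L)
      have hmain := integral_mono (hl1.add hl2) hi4 hstep
      have hmain' : ((k + 1 : ℝ) * (k + 2)) * A (k + 1) + 3 * L * B (k + 1) ≤
          (k * (k + 1 : ℝ)) * A k + 3 * L * B k + 4 * L * Dt t ^ 2 / N t +
            (k + 1 : ℝ) ^ 2 / L * ∫ ω, ‖δ (X ω)‖ ^ 2 ∂P := by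
        rw [integral_add' hl1 hl2, integral_sub' hi3 (hinti.const_mul _),
          integral_add' hi2 (hintδ.const_mul _), integral_add' hi1 (integrable_const _),
          integral_add' ((hintA k).const_mul _) ((hintD k).const_mul _), integral_const_mul,
          integral_const_mul, integral_const_mul, integral_const_mul, integral_const_mul,
          integral_const_mul, horth, integral_const] at hmain
        simpa using hmain
      have hfirst : ((k + 1 : ℕ) : ℝ) * ((k + 1 : ℕ) + 1) * A (k + 1) + 3 * L * B (k + 1) ≤
          3 * L * Dt t ^ 2 + 5 * (k + 1 : ℕ) * (L * Dt t ^ 2 / N t) := by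
        have e1 : 4 * L * Dt t ^ 2 / N t = 4 * (L * Dt t ^ 2 / N t) := by ring
        push_cast
        rw [e1] at hmain'
        have e2 : ((k : ℝ) + 1) * (k + 1 + 1) = (k + 1 : ℝ) * (k + 2) := by ring
        rw [e2]
        linarith
      refine ⟨hfirst, ?_⟩
      have hBle : B (k + 1) ≤ 8 / 3 * Dt t ^ 2 := by
        have h0 : 0 ≤ ((k + 1 : ℕ) : ℝ) * ((k + 1 : ℕ) + 1) * A (k + 1) :=
          mul_nonneg (by positivity) (hA0 _ hk)
        have h3 : 5 * ((k + 1 : ℕ) : ℝ) * (L * Dt t ^ 2 / N t) ≤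
            5 * (N t * (L * Dt t ^ 2 / N t)) := by
          rw [mul_assoc]; gcongr
        have h1 : L * (3 * B (k + 1)) ≤ L * (8 * Dt t ^ 2) := by linarith
        have h2 := le_of_mul_le_mul_left h1 hL
        linarith
      have hCle : C (k + 1) ≤ (1 - γ) * C k + γ * B (k + 1) := by
        have h1 := integral_mono (hintE (k + 1))
          (((hintE k).const_mul (1 - γ)).add ((hintD (k + 1)).const_mul γ)) fun ω => by
            exact norm_combination_sub_sq_le hγ0 hγ1 (x (k + 1) (X ω)) (y k (X ω)) wstar
        rwa [integral_add' ((hintE k).const_mul _) ((hintD (k + 1)).const_mul _),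
          integral_const_mul, integral_const_mul] at h1
      have h1 := mul_le_mul_of_nonneg_left ih2 (by linarith : 0 ≤ 1 - γ)
      have h2 := mul_le_mul_of_nonneg_left hBle hγ0
      linarith
  have h1 := (key (N t) le_rfl).1
  have h2 : N t * (L * Dt t ^ 2 / N t) = L * Dt t ^ 2 := by field_simp
  have h3 : 0 ≤ 3 * L * B (N t) := mul_nonneg (by positivity) (hB0 _)
  change (N t : ℝ) * (N t + 1) * A (N t) ≤ _
  linarith

end Expectation

/-! ### Numerical bounds on the number of inner iterations. -/

section Parameters

/-- The number of inner iterations in the first two cases. -/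
theorem ceil_two_rpow_bounds {t N : ℕ} (ht : 1 ≤ t) (hN : N = ⌈(2 : ℝ) ^ ((t : ℝ) / 2 + 2)⌉₊) :
    1 ≤ N ∧ ((N : ℝ) + 1) ^ 2 ≤ 30 * 2 ^ t ∧ 16 * 2 ^ t ≤ (N : ℝ) * (N + 1) := by
  set r := (2 : ℝ) ^ ((t : ℝ) / 2) with hr
  have hr0 : 0 < r := by positivity
  have hr2 : r ^ 2 = 2 ^ t := by
    rw [hr, ← Real.rpow_natCast ((2 : ℝ) ^ ((t : ℝ) / 2)), ← Real.rpow_mul (by norm_num),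
      ← Real.rpow_natCast]
    congr 1
    push_cast
    ring
  have hq : (2 : ℝ) ^ ((t : ℝ) / 2 + 2) = 4 * r := by
    rw [Real.rpow_add (by norm_num), Real.rpow_two]; ring
  rw [hq] at hN
  have h1 : 4 * r ≤ N := by rw [hN]; exact Nat.le_ceil _
  have h2 : (N : ℝ) < 4 * r + 1 := by rw [hN]; exact Nat.ceil_lt_add_one (by positivity)
  have h3 : (2 : ℝ) ≤ r ^ 2 := by
    rw [hr2]
    calc (2 : ℝ) = 2 ^ 1 := by norm_num
      _ ≤ 2 ^ t := pow_le_pow_right₀ (by norm_num) ht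
  -- Needed for (4r + 2)² ≤ 30r², which fails for small r.
  have h4 : 1.4 ≤ r := by nlinarith
  rw [← hr2]
  refine ⟨?_, by nlinarith, by nlinarith⟩
  have : (0 : ℝ) < N := by linarith
  exact_mod_cast this

/-- The number of inner iterations in the strongly convex case. -/
theorem ceil_sqrt_bounds {N : ℕ} {μ : ℝ} (hμ : 1 ≤ μ) (hN : N = ⌈Real.sqrt (32 * μ)⌉₊) :
    1 ≤ N ∧ ((N : ℝ) + 1) ^ 2 ≤ 60 * μ ∧ 32 * μ ≤ (N : ℝ) * (N + 1) := by
  set s := Real.sqrt (32 * μ) with hs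
  have hs0 : 0 ≤ s := Real.sqrt_nonneg _
  have hs2 : s ^ 2 = 32 * μ := Real.sq_sqrt (by positivity)
  have h1 : s ≤ N := by rw [hN]; exact Nat.le_ceil _
  have h2 : (N : ℝ) < s + 1 := by rw [hN]; exact Nat.ceil_lt_add_one hs0
  -- Needed for (s + 2)² ≤ 60μ = (15/8)s².
  have h4 : 5.6 ≤ s := by nlinarith
  refine ⟨?_, by nlinarith, by nlinarith⟩
  have : (0 : ℝ) < N := by linarith
  exact_mod_cast this

end Parameters

/-! ### Induction over the outer iterations. -/

section Convergence

variable {d n : ℕ} {L : ℝ}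

/-- Geometric decrease of the expected optimality gap, provided that the squared distance to `wstar`
is controlled by the optimality gap and the parameters are large enough. -/
theorem integral_iterate_le (hL : 0 < L) (hn : 0 < n) {K : Set (Vec d)} (hK : Convex ℝ K) {D : ℝ}
    {F : Fin n → Vec d → ℝ} (hF : ∀ i, IsConvexSmooth L (F i)) {wstar : Vec d} (hwstar : wstar ∈ K)
    (hmin : ∀ u ∈ K, objective F wstar ≤ objective F u)
    {Dt : ℕ → ℝ} {N : ℕ → ℕ} {m : ℕ → ℕ → ℕ} {solver : ℕ → ℕ → Vec d → Vec d → Vec d}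
    (hsolver : IsFrankWolfeSolver K (params L Dt N m) solver)
    {S : Type*} [MeasurableSpace S] {P : Measure S} [IsProbabilityMeasure P]
    {X : S → ℕ × ℕ × ℕ → Fin n} (hX : ∀ s, Measurable fun ω => X ω s)
    (hind : iIndepFun (fun s ω => X ω s) P)
    (hunif : ∀ s i, P {ω | X ω s = i} = (n : ENNReal)⁻¹)
    {w₀ : Vec d} (hw₀ : w₀ ∈ K) (hinit : objective F w₀ - objective F wstar ≤ L * D ^ 2 / 2)
    (hN : ∀ t, 1 ≤ t → 1 ≤ N t) (hm : ∀ t, 1 ≤ t → ∀ k, 1 ≤ k → 700 * N t ≤ m t k)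
    (hdist : ∀ t, ∃ b c : ℝ, 0 ≤ c ∧ b + c * (L * D ^ 2 / 2 ^ (t + 1)) ≤ Dt (t + 1) ^ 2 ∧
      ∀ u ∈ K, ‖u - wstar‖ ^ 2 ≤ b + c * (objective F u - objective F wstar))
    (hNle : ∀ t, 1 ≤ t → ((N t : ℝ) + 1) ^ 2 * (L * D ^ 2 / 2 ^ t) ≤ 30 * L * Dt t ^ 2)
    (hNge : ∀ t, 1 ≤ t →
      8 * L * Dt t ^ 2 ≤ (N t : ℝ) * (N t + 1) * (L * D ^ 2 / 2 ^ (t + 1))) (t : ℕ) :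
    ∫ ω, (objective F (iterate F (params L Dt N m) solver w₀ (fun t k j => X ω (t, k, j)) t) -
      objective F wstar) ∂P ≤ L * D ^ 2 / 2 ^ (t + 1) := by
  induction t with
  | zero => simpa [iterate] using hinit
  | succ t ih =>
    set w : (ℕ × ℕ × ℕ → Fin n) → Vec d := fun a =>
      iterate F (params L Dt N m) solver w₀ (fun t k j => a (t, k, j)) t with hwdef
    have hw : DependsOn w (usedIndices (params L Dt N m) (t + 1) 0) :=
      dependsOn_iterate F _ solver w₀ t
    have hwK : ∀ a, w a ∈ K := fun a => iterate_mem hK F (params_γ_mem L Dt N m) hsolver hw₀ _ t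
    have ht : 1 ≤ t + 1 := by omega
    have hfin := finite_usedIndices (params L Dt N m) (t + 1) 0
    have hintW : Integrable (fun ω => objective F (w (X ω)) - objective F wstar) P :=
      integrable_of_dependsOn hX hfin (Z := fun a => objective F (w a) - objective F wstar)
        fun a b hab => by simp only [hw hab]
    have hintD : Integrable (fun ω => ‖w (X ω) - wstar‖ ^ 2) P :=
      integrable_of_dependsOn hX hfin (Z := fun a => ‖w a - wstar‖ ^ 2)
        fun a b hab => by simp only [hw hab]
    have hD : ∫ ω, ‖w (X ω) - wstar‖ ^ 2 ∂P ≤ Dt (t + 1) ^ 2 := by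
      -- Taking expectations, the induction hypothesis on the gap bounds the mean squared distance
      -- of the snapshot.
      obtain ⟨b, c, hc, hle, hbc⟩ := hdist t
      have h1 := integral_mono hintD ((integrable_const b).add (hintW.const_mul c)) fun ω =>
        hbc _ (hwK (X ω))
      rw [integral_add' (integrable_const b) (hintW.const_mul c), integral_const_mul] at h1
      simp only [integral_const, probReal_univ, one_smul] at h1
      have h2 := mul_le_mul_of_nonneg_left ih hc
      linarith
    have h1 := integral_innerLoop_le hL hn hK hF hwstar hmin hsolver hX hind hunif ht (hN _ ht)
      (hm _ ht) hw hwK hD ih (hNle _ ht)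
    have hNpos : (0 : ℝ) < N (t + 1) := by exact_mod_cast hN _ ht
    exact le_of_mul_le_mul_left (h1.trans (hNge _ ht)) (by positivity)

end Convergence

end STORC

end

/-! ### The three parameter choices. -/

theorem theorem2 {d n : ℕ}
    -- the problem
    (K : Set (STORC.Vec d)) (hKcompact : IsCompact K) (hKconvex : Convex ℝ K)
    (D : ℝ) (hD : D = Metric.diam K)
    (L : ℝ) (hL : 0 < L)
    (F : Fin n → STORC.Vec d → ℝ) (hF : ∀ i, STORC.IsConvexSmooth L (F i))
    (wstar : STORC.Vec d) (hwstar : wstar ∈ K)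
    (hmin : ∀ w ∈ K, STORC.objective F wstar ≤ STORC.objective F w)
    -- the parameters, in one of the three cases
    (Dt : ℕ → ℝ) (N : ℕ → ℕ) (m : ℕ → ℕ → ℕ)
    (hcase :
      (gradient (STORC.objective F) wstar = 0 ∧
        ∀ t : ℕ, 1 ≤ t → Dt t = D ∧ N t = ⌈(2 : ℝ) ^ ((t : ℝ) / 2 + 2)⌉₊ ∧
          ∀ k : ℕ, 1 ≤ k → m t k = 900 * N t) ∨
      (∃ G : ℝ, STORC.IsGLipschitz K G (STORC.objective F) ∧
        ∀ t : ℕ, 1 ≤ t → Dt t = D ∧ N t = ⌈(2 : ℝ) ^ ((t : ℝ) / 2 + 2)⌉₊ ∧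
          ∀ k : ℕ, 1 ≤ k →
            m t k = ⌈700 * (N t : ℝ) + 24 * (N t : ℝ) * G * ((k : ℝ) + 1) / (L * D)⌉₊) ∨
      (∃ α μ : ℝ, 0 < α ∧ STORC.IsStronglyConvex K α (STORC.objective F) ∧ μ = L / α ∧
        ∀ t : ℕ, 1 ≤ t →
          Dt t ^ 2 = μ * D ^ 2 / (2 : ℝ) ^ (t - 1) ∧ N t = ⌈Real.sqrt (32 * μ)⌉₊ ∧
          ∀ k : ℕ, 1 ≤ k → m t k = ⌈5600 * (N t : ℝ) * μ⌉₊))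
    -- the initial point, the inner solver and the random indices
    (x₀ : STORC.Vec d) (hx₀ : x₀ ∈ K)
    (w₀ : STORC.Vec d) (hw₀ : STORC.IsLinearArgmin K (gradient (STORC.objective F) x₀) w₀)
    (solver : ℕ → ℕ → STORC.Vec d → STORC.Vec d → STORC.Vec d)
    (hsolver : STORC.IsFrankWolfeSolver K (STORC.params L Dt N m) solver)
    {S : Type*} [MeasurableSpace S] (P : MeasureTheory.Measure S)
    [MeasureTheory.IsProbabilityMeasure P]
    (idx : ℕ → ℕ → ℕ → S → Fin n) (hidx : STORC.IsIIDUniform P idx) (t : ℕ) :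
    MeasureTheory.Integrable (fun ω =>
        STORC.objective F (STORC.iterate F (STORC.params L Dt N m) solver w₀
          (fun t k j => idx t k j ω) t) - STORC.objective F wstar) P ∧
      ∫ ω, (STORC.objective F (STORC.iterate F (STORC.params L Dt N m) solver w₀
          (fun t k j => idx t k j ω) t) - STORC.objective F wstar) ∂P
        ≤ L * D ^ 2 / (2 : ℝ) ^ (t + 1) := by
  have hn : 0 < n := by
    obtain ⟨ω⟩ := MeasureTheory.nonempty_of_isProbabilityMeasure P
    exact Fin.pos (idx 0 0 0 ω)
  have hf := STORC.isConvexSmooth_objective hn hF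
  have hX : ∀ s : ℕ × ℕ × ℕ, Measurable fun ω => idx s.1 s.2.1 s.2.2 ω := fun s =>
    hidx.measurable _ _ _
  constructor
  · exact STORC.integrable_of_dependsOn (X := fun ω (s : ℕ × ℕ × ℕ) => idx s.1 s.2.1 s.2.2 ω) hX
      (STORC.finite_usedIndices _ _ _)
      (Z := fun a => STORC.objective F (STORC.iterate F (STORC.params L Dt N m) solver w₀
        (fun t k j => a (t, k, j)) t) - STORC.objective F wstar)
      fun a b hab => by
        have h := STORC.dependsOn_iterate F (STORC.params L Dt N m) solver w₀ t hab
        simp only at h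
        simp only [h]
  have hdiam : ∀ u ∈ K, ∀ v ∈ K, ‖u - v‖ ≤ D := fun u hu v hv => by
    rw [hD, ← dist_eq_norm]; exact Metric.dist_le_diam_of_mem hKcompact.isBounded hu hv
  have hD0 : 0 ≤ D := by rw [hD]; exact Metric.diam_nonneg
  -- On a single point strong convexity does not force α ≤ L, so μ ≥ 1 could fail; there the gap is
  -- zero.
  rcases hD0.eq_or_lt with hD0 | hDpos
  · have hmem := STORC.iterate_mem hKconvex F (STORC.params_γ_mem L Dt N m) hsolver hw₀.1
    have heq : ∀ u ∈ K, u = wstar := fun u hu => by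
      have h := hdiam u hu wstar hwstar
      rw [← hD0] at h
      exact sub_eq_zero.1 (norm_le_zero_iff.1 h)
    simp [heq _ (hmem _ t), ← hD0]
  have hdist : ∀ u ∈ K, ‖u - wstar‖ ^ 2 ≤ D ^ 2 := fun u hu =>
    pow_le_pow_left₀ (norm_nonneg _) (hdiam u hu _ hwstar) 2
  have hinit : STORC.objective F w₀ - STORC.objective F wstar ≤ L * D ^ 2 / 2 := by
    rw [hD]; exact hw₀.objective_sub_le hKcompact hL hf hx₀ hwstar
  have main := fun h1 h2 h3 h4 h5 => STORC.integral_iterate_le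
    (X := fun ω (s : ℕ × ℕ × ℕ) => idx s.1 s.2.1 s.2.2 ω) hL hn hKconvex hF hwstar hmin hsolver hX
    hidx.indep (fun s i => hidx.uniform _ _ _ i) hw₀.1 hinit h1 h2 h3 h4 h5 t
  -- The variance is bounded through `‖∇f_i(z_k) - ∇f_i(y_{k-1})‖ ≤ L ‖z_k - y_{k-1}‖` and first-order
  -- optimality, so the first two cases need only that the batches have at least `700 N` samples.
  have large_batch_case : (∀ t : ℕ, 1 ≤ t → Dt t = D ∧ N t = ⌈(2 : ℝ) ^ ((t : ℝ) / 2 + 2)⌉₊ ∧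
      ∀ k : ℕ, 1 ≤ k → 700 * N t ≤ m t k) →
      ∫ ω, (STORC.objective F (STORC.iterate F (STORC.params L Dt N m) solver w₀
          (fun t k j => idx t k j ω) t) - STORC.objective F wstar) ∂P
        ≤ L * D ^ 2 / (2 : ℝ) ^ (t + 1) := by
    intro h
    -- Here b = D² and c = 0: the diameter alone bounds the distance.
    refine main (fun t ht => (STORC.ceil_two_rpow_bounds ht (h t ht).2.1).1)
      (fun t ht => (h t ht).2.2) (fun t => ⟨D ^ 2, 0, le_rfl, ?_, fun u hu => ?_⟩)
      (fun t ht => ?_) (fun t ht => ?_)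
    · rw [(h (t + 1) (by omega)).1]; simp
    · simpa using hdist u hu
    · rw [(h t ht).1, mul_div_assoc', div_le_iff₀ (by positivity)]
      have h2 := mul_le_mul_of_nonneg_right (STORC.ceil_two_rpow_bounds ht (h t ht).2.1).2.1
        (by positivity : 0 ≤ L * D ^ 2)
      linarith
    · rw [(h t ht).1, mul_div_assoc', le_div_iff₀ (by positivity)]
      have h2 := mul_le_mul_of_nonneg_right (STORC.ceil_two_rpow_bounds ht (h t ht).2.1).2.2
        (by positivity : 0 ≤ L * D ^ 2)
      rw [pow_succ (2 : ℝ)]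
      linarith
  rcases hcase with ⟨-, h⟩ | ⟨G, hG, h⟩ | ⟨α, μ, hα, hsc, hμ, h⟩
  · refine large_batch_case fun t ht => ⟨(h t ht).1, (h t ht).2.1, fun k hk => ?_⟩
    rw [(h t ht).2.2 k hk]
    omega
  · have hG0 : 0 ≤ G := (norm_nonneg _).trans (hG wstar hwstar)
    refine large_batch_case fun t ht => ⟨(h t ht).1, (h t ht).2.1, fun k hk => ?_⟩
    have h1 : 700 * (N t : ℝ) ≤ m t k := by
      rw [(h t ht).2.2 k hk]
      refine le_trans ?_ (Nat.le_ceil _)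
      have : 0 ≤ 24 * (N t : ℝ) * G * ((k : ℝ) + 1) / (L * D) := by positivity
      linarith
    exact_mod_cast h1
  · have hαL : α ≤ L := by
      by_contra hlt
      have heq : ∀ u ∈ K, u = wstar := fun u hu => by
        by_contra hne
        exact hlt (hsc.le_of_ne hf hwstar hu hne)
      have : Metric.diam K = 0 := Metric.diam_subsingleton fun u hu v hv => by
        rw [heq u hu, heq v hv]
      exact hDpos.ne' (hD.trans this)
    have hμ1 : 1 ≤ μ := by rw [hμ, le_div_iff₀ hα]; linarith
    have hb := fun t ht => STORC.ceil_sqrt_bounds hμ1 (h t ht).2.1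
    -- Here b = 0 and c = 2/α from quadratic growth; D_{t+1}² is exactly 2/α times the bound on the
    -- gap at w_t.
    refine main (fun t ht => (hb t ht).1) (fun t ht k hk => ?_)
      (fun t => ⟨0, 2 / α, by positivity, ?_, fun u hu => ?_⟩) (fun t ht => ?_) (fun t ht => ?_)
    · have h1 : 700 * (N t : ℝ) ≤ m t k := by
        rw [(h t ht).2.2 k hk]
        refine le_trans ?_ (Nat.le_ceil _)
        have : (0 : ℝ) ≤ N t := Nat.cast_nonneg _
        nlinarith
      exact_mod_cast h1
    · rw [(h (t + 1) (by omega)).1, hμ, Nat.add_sub_cancel, pow_succ (2 : ℝ)]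
      apply le_of_eq
      field_simp
      ring
    · have h1 := hsc.norm_sub_sq_le hKconvex hf hwstar hu hmin
      rw [zero_add, div_mul_eq_mul_div, le_div_iff₀ hα]
      linarith
    · obtain ⟨s, rfl⟩ : ∃ s, t = s + 1 := ⟨t - 1, by omega⟩
      rw [(h _ ht).1, Nat.add_sub_cancel, mul_div_assoc', mul_div_assoc', pow_succ (2 : ℝ),
        div_le_div_iff₀ (by positivity) (by positivity)]
      have h2 := mul_le_mul_of_nonneg_right (hb _ ht).2.1
        (by positivity : 0 ≤ L * D ^ 2 * 2 ^ s)
      linarith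
    · obtain ⟨s, rfl⟩ : ∃ s, t = s + 1 := ⟨t - 1, by omega⟩
      rw [(h _ ht).1, Nat.add_sub_cancel, mul_div_assoc', mul_div_assoc', pow_succ (2 : ℝ),
        pow_succ (2 : ℝ), div_le_div_iff₀ (by positivity) (by positivity)]
      have h2 := mul_le_mul_of_nonneg_right (hb _ ht).2.2
        (by positivity : 0 ≤ L * D ^ 2 * 2 ^ s)
      linarith
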